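/- Let $n\ge 1$ and identify pure $n$-qubit states with points $[\phi]$ of the projective space of $(\mathbb{C}^2)^{\otimes n}$, where $0\ne\phi\in(\mathbb{C}^2)^{\otimes n}$. The $n$-qubit Pauli group is the group generated by all $n$-fold tensor products of the operators $\mathbb{1}$, $X=\begin{pmatrix}0&1\\1&0\end{pmatrix}$, $Z=\begin{pmatrix}1&0\\0&-1\end{pmatrix}$ and $i\mathbb{1}$ on $\mathbb{C}^2$; the Clifford group is its normalizer in the unitary group of $(\mathbb{C}^2)^{\otimes n}$; and the stabilizer states are the states $[U \mathrm{e}_0^{\otimes n}]$ with $U$ in the Clifford group, where $\mathrm{e}_0,\mathrm{e}_1$ is the computational basis of $\mathbb{C}^2$. The stabilizer rank $\chi([\phi])$ is the smallest integer $r$ for which $\phi=\sum_{i=1}^r c_i\sigma_i$ for some $c_i\in\mathbb{C}$ and some stabilizer states $[\sigma_i]$. For $\delta>0$ the $\delta$-approximate stabilizer rank is $$\chi_\delta([\psi])=\min\Big\{\chi([\phi]) : \Big\|\frac{\phi}{\|\phi\|}-\frac{\psi}{\|\psi\|}\Big\|<\delta\Big\},$$ where $\phi$ ranges over the non-zero vectors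 of the same space and $\|\cdot\|$ is the Euclidean norm. Theorem. For every single-qubit state $[\psi]$ that is not a stabilizer state, there exists a constant $\delta>0$ such that, for every integer $n\ge 2$, $$\chi_\delta([\psi^{\otimes n}])\ \ge\ \frac{\sqrt n}{2\log_2 n}.$$ -/

import Mathlib

open scoped LinearAlgebra.Projectivization

noncomputable section

namespace StabRank

/-- Labels of the computational basis of `n` qubits. -/
abbrev Bits (n : ℕ) : Type := Fin n → Fin 2

/-- The `n`-qubit space `(ℂ²)^{⊗ n}`, in coordinates with respect to the computational basis
`e_x = e_{x 0} ⊗ ⋯ ⊗ e_{x (n-1)}`, with its Euclidean norm. -/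
abbrev QSpace (n : ℕ) : Type := EuclideanSpace ℂ (Bits n)

/-- Pure `n`-qubit states: points of the projective space of `(ℂ²)^{⊗ n}`. -/
abbrev QState (n : ℕ) : Type := ℙ ℂ (QSpace n)

/-- The Pauli matrix `X`. -/
def pauliX : Matrix (Fin 2) (Fin 2) ℂ := !![0, 1; 1, 0]

/-- The Pauli matrix `Z`. -/
def pauliZ : Matrix (Fin 2) (Fin 2) ℂ := !![1, 0; 0, -1]

/-- The tensor product `A 0 ⊗ ⋯ ⊗ A (n-1)` of operators on `ℂ²`, as a matrix in the
computational basis of `(ℂ²)^{⊗ n}`. -/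
def tensorOp {n : ℕ} (A : Fin n → Matrix (Fin 2) (Fin 2) ℂ) : Matrix (Bits n) (Bits n) ℂ :=
  Matrix.of fun x y => ∏ i, A i (x i) (y i)

/-- The `n`-qubit Pauli group: the group of unitaries generated by the `n`-fold tensor products
of the operators `1`, `X`, `Z` and `i · 1` on `ℂ²`. -/
def pauliGroup (n : ℕ) : Subgroup (Matrix.unitaryGroup (Bits n) ℂ) :=
  Subgroup.closure {P | ∃ A : Fin n → Matrix (Fin 2) (Fin 2) ℂ,
    (∀ i, A i = 1 ∨ A i = pauliX ∨ A i = pauliZ ∨ A i = Complex.I • 1) ∧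
      (P : Matrix (Bits n) (Bits n) ℂ) = tensorOp A}

/-- The Clifford group: the normalizer of the Pauli group in the unitary group. -/
def cliffordGroup (n : ℕ) : Subgroup (Matrix.unitaryGroup (Bits n) ℂ) :=
  Subgroup.normalizer (pauliGroup n : Set (Matrix.unitaryGroup (Bits n) ℂ))

/-- The computational basis vector `e_0^{⊗ n}`. -/
def ketZero (n : ℕ) : QSpace n := EuclideanSpace.single (fun _ => 0) 1

/-- The stabilizer states: the orbit of `[e_0^{⊗ n}]` under the Clifford group. -/
def stabStates (n : ℕ) : Set (QState n) :=
  {s | ∃ U ∈ cliffordGroup n,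
    ∃ h : Matrix.toEuclideanLin (U : Matrix (Bits n) (Bits n) ℂ) (ketZero n) ≠ 0,
      s = Projectivization.mk ℂ
        (Matrix.toEuclideanLin (U : Matrix (Bits n) (Bits n) ℂ) (ketZero n)) h}

/-- The stabilizer rank of a state: the least `r` such that a vector representing the state is a
linear combination of `r` vectors representing stabilizer states. -/
def stabRank {n : ℕ} (s : QState n) : ℕ :=
  sInf {r : ℕ | ∃ (c : Fin r → ℂ) (σ : Fin r → QSpace n) (hσ : ∀ i, σ i ≠ 0),
    (∀ i, Projectivization.mk ℂ (σ i) (hσ i) ∈ stabStates n) ∧ s.rep = ∑ i, c i • σ i}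

/-- The `δ`-approximate stabilizer rank of a state `s = [ψ]`: the least stabilizer rank of a state
`[φ]` with `‖φ / ‖φ‖ - ψ / ‖ψ‖‖ < δ`. Here `φ` ranges over vectors, so every choice of global
phase is allowed, and the value does not depend on the representative of `s`. -/
def approxStabRank {n : ℕ} (δ : ℝ) (s : QState n) : ℕ :=
  sInf {r : ℕ | ∃ (φ : QSpace n) (hφ : φ ≠ 0),
    ‖((‖φ‖⁻¹ : ℝ) : ℂ) • φ - ((‖s.rep‖⁻¹ : ℝ) : ℂ) • s.rep‖ < δ ∧
      stabRank (Projectivization.mk ℂ φ hφ) = r}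

/-- The tensor power `ψ^{⊗ n}` of a single-qubit vector `ψ`: its coordinate at
`x` is the product over `i` of the coordinates of `ψ` at `x i`. -/
def tensorPow (n : ℕ) (ψ : QSpace 1) : QSpace n :=
  WithLp.toLp 2 fun x => ∏ i, ψ (fun _ => x i)

theorem tensorPow_ne_zero (n : ℕ) {ψ : QSpace 1} (hψ : ψ ≠ 0) : tensorPow n ψ ≠ 0 := by
  intro h
  apply hψ
  ext b
  have hb : b = fun _ => b 0 := by
    funext j
    rw [Subsingleton.elim j 0]
  by_contra hne
  have h1 := congrArg (fun v : QSpace n => v (fun _ => b 0)) h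
  simp only [tensorPow, PiLp.zero_apply] at h1
  rw [Finset.prod_const, ← hb] at h1
  exact hne (eq_zero_of_pow_eq_zero h1)

end StabRank

end

open Matrix

namespace StabRank

/-! The coordinates of a combination of few stabilizer states satisfy many small integer relations,
whereas those of a vector near `ψ^{⊗n}` range over too many scales for such relations to hold.

A local Clifford operator turns `ψ` into a unit vector `w` with `3‖w 1‖² ≤ ‖w 0‖²`
(`exists_isLocalClifford_dominant`), and `w 1 ≠ 0` because `[ψ]` is not a stabilizer state. The
coordinate of `w^{⊗n}` at a string with `k` zeros has modulus `‖w 0‖^k ‖w 1‖^(n-k)`, which at least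
triples when `k` grows by 2. The squared moduli distribute `k` binomially, so about `√n` consecutive
levels each carry weight of order `1/√n` (`exists_heavy_window`). If `φ` is within a constant `δ` of
`w^{⊗n}`, it must be accurate somewhere on many of these levels. This gives `s ≈ √n` coordinates of
`φ`, each at least twice the previous one in modulus, so their `2^s` subset sums are distinct.

Up to a common factor, stabilizer vectors have coordinates in `{0, ±1, ±i}` (`stabilizer_coords`).
If `φ` is a combination of `r` of them, every such subset sum is a combination of `r` fixed numbers
with Gaussian integer coefficients of real and imaginary part at most `s` in absolute value, so
there are at most `(2s+1)^(2r)` sums. Hence `2^s ≤ (2s+1)^(2r)` (`two_pow_card_le`), and taking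
logarithms bounds `r` from below. -/

/-! ### Doubling families and the count of their subset sums -/

/-- If every term of a finite family is at least twice as large as each earlier one, the family
sums to less than twice its largest term. -/
theorem sum_norm_lt_of_doubling {ι : Type*} [LinearOrder ι] (G : Finset ι) (z : ι → ℂ)
    (hz : ∀ k ∈ G, z k ≠ 0) (h : ∀ j ∈ G, ∀ k ∈ G, j < k → 2 * ‖z j‖ ≤ ‖z k‖) :
    ∀ y : ℝ, 0 < y → (∀ k ∈ G, 2 * ‖z k‖ ≤ y) → ∑ k ∈ G, ‖z k‖ < y := by
  induction G using Finset.induction_on_max with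
  | empty => intro y hy _; simpa using hy
  | insert a s ha ih =>
    intro y hy hG
    have hna : a ∉ s := fun hs => lt_irrefl _ (ha a hs)
    have h1 := ih (fun k hk => hz k (Finset.mem_insert_of_mem hk))
      (fun j hj k hk => h j (Finset.mem_insert_of_mem hj) k (Finset.mem_insert_of_mem hk))
      ‖z a‖ (norm_pos_iff.mpr (hz a (Finset.mem_insert_self _ _)))
      (fun k hk => h k (Finset.mem_insert_of_mem hk) a (Finset.mem_insert_self _ _) (ha k hk))
    have h2 := hG a (Finset.mem_insert_self _ _)
    rw [Finset.sum_insert hna]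
    linarith

/-- The subset sums of a doubling family are distinct. -/
theorem subset_sums_injOn {ι : Type*} [LinearOrder ι] (G : Finset ι) (z : ι → ℂ)
    (hz : ∀ k ∈ G, z k ≠ 0) (h : ∀ j ∈ G, ∀ k ∈ G, j < k → 2 * ‖z j‖ ≤ ‖z k‖) :
    Set.InjOn (fun T : Finset ι => ∑ k ∈ T, z k) (G.powerset : Set (Finset ι)) := by
  intro T hT T' hT' heq
  simp only [Finset.coe_powerset, Set.mem_preimage, Set.mem_powerset_iff, Finset.coe_subset]
    at hT hT'
  by_contra hne
  simp only at heq
  have hD : (symmDiff T T').Nonempty := by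
    rw [Finset.nonempty_iff_ne_empty]
    exact fun he => hne (symmDiff_eq_bot.mp he)
  set b := (symmDiff T T').max' hD with hb
  have hbm : b ∈ symmDiff T T' := Finset.max'_mem _ _
  have hDG : symmDiff T T' ⊆ G := by
    intro x hx
    rcases Finset.mem_symmDiff.mp hx with hx | hx
    · exact hT hx.1
    · exact hT' hx.1
  have key : ∑ k ∈ T \ T', z k = ∑ k ∈ T' \ T, z k := by
    have e1 := Finset.sum_sdiff (f := z) (Finset.inter_subset_left (s₁ := T) (s₂ := T'))
    have e2 := Finset.sum_sdiff (f := z) (Finset.inter_subset_left (s₁ := T') (s₂ := T))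
    rw [Finset.sdiff_inter_self_left] at e1 e2
    rw [Finset.inter_comm] at e2
    exact add_right_cancel (e1.trans (heq.trans e2.symm))
  have hdisj : Disjoint (T \ T') (T' \ T) := disjoint_sdiff_sdiff
  have hsd : symmDiff T T' = (T \ T') ∪ (T' \ T) := rfl
  -- the largest term is bounded by the others
  have hle : ‖z b‖ ≤ ∑ k ∈ (symmDiff T T').erase b, ‖z k‖ := by
    -- Equal sums over `T` and `T'` make the signed sum over the symmetric difference vanish, so the
    -- term at `b` is minus the sum of the others.
    let e : ι → ℂ := fun k => if k ∈ T then z k else - z k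
    have hen : ∀ k, ‖e k‖ = ‖z k‖ := by
      intro k; simp only [e]; split_ifs <;> simp
    have hs0 : ∑ k ∈ symmDiff T T', e k = 0 := by
      rw [hsd, Finset.sum_union hdisj]
      have a1 : ∑ k ∈ T \ T', e k = ∑ k ∈ T \ T', z k :=
        Finset.sum_congr rfl fun k hk => if_pos (Finset.mem_sdiff.mp hk).1
      have a2 : ∑ k ∈ T' \ T, e k = ∑ k ∈ T' \ T, - z k :=
        Finset.sum_congr rfl fun k hk => if_neg (Finset.mem_sdiff.mp hk).2
      rw [a1, a2, key, Finset.sum_neg_distrib, add_neg_cancel]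
    have h3 := Finset.add_sum_erase _ e hbm
    rw [hs0] at h3
    rw [← hen b, eq_neg_of_add_eq_zero_left h3, norm_neg]
    refine (norm_sum_le _ _).trans (le_of_eq ?_)
    exact Finset.sum_congr rfl fun k _ => hen k
  have hsub : (symmDiff T T').erase b ⊆ G := (Finset.erase_subset _ _).trans hDG
  have hlt := sum_norm_lt_of_doubling ((symmDiff T T').erase b) z (fun k hk => hz k (hsub hk))
    (fun j hj k hk => h j (hsub hj) k (hsub hk)) ‖z b‖ (norm_pos_iff.mpr (hz b (hDG hbm)))
    (fun k hk => h k (hsub hk) b (hDG hbm)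
      (lt_of_le_of_ne (Finset.le_max' _ _ (Finset.mem_of_mem_erase hk)) (Finset.ne_of_mem_erase hk)))
  exact absurd hle (not_le.mpr hlt)

/-- A doubling family of `m` numbers that are combinations of `r` fixed numbers with small
Gaussian integer coefficients satisfies `2 ^ m ≤ (2 m + 1) ^ (2 r)`. -/
theorem two_pow_card_le {ι : Type*} [LinearOrder ι] {r : ℕ} (G : Finset ι) (z : ι → ℂ)
    (hz : ∀ k ∈ G, z k ≠ 0) (h : ∀ j ∈ G, ∀ k ∈ G, j < k → 2 * ‖z j‖ ≤ ‖z k‖)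
    (c : Fin r → ℂ) (u v : ι → Fin r → ℤ) (hu : ∀ k i, |u k i| ≤ 1) (hv : ∀ k i, |v k i| ≤ 1)
    (hzc : ∀ k ∈ G, z k = ∑ i, c i * ((u k i : ℂ) + (v k i : ℂ) * Complex.I)) :
    2 ^ G.card ≤ (2 * G.card + 1) ^ (2 * r) := by
  let I : Finset ℤ := Finset.Icc (-(G.card : ℤ)) G.card
  have hI : I.card = 2 * G.card + 1 := by
    simp only [I, Int.card_Icc]; omega
  have hbd : ∀ w : ι → Fin r → ℤ, (∀ k i, |w k i| ≤ 1) → ∀ T ∈ G.powerset, ∀ i,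
      ∑ k ∈ T, w k i ∈ I := by
    intro w hw T hT i
    have h1 : |∑ k ∈ T, w k i| ≤ G.card := by
      calc |∑ k ∈ T, w k i| ≤ ∑ k ∈ T, |w k i| := Finset.abs_sum_le_sum_abs _ _
        _ ≤ ∑ k ∈ T, 1 := Finset.sum_le_sum fun k _ => hw k i
        _ = T.card := by simp
        _ ≤ G.card := by exact_mod_cast Finset.card_le_card (Finset.mem_powerset.mp hT)
    exact Finset.mem_Icc.mpr (abs_le.mp h1)
  -- A subset is sent to its vector of summed integer coefficients. This vector determines the
  -- subset sum, hence the subset.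
  have hcard : G.powerset.card ≤ (Fintype.piFinset fun _ : Fin r => I ×ˢ I).card := by
    refine Finset.card_le_card_of_injOn
      (fun T i => (∑ k ∈ T, u k i, ∑ k ∈ T, v k i)) ?_ ?_
    · intro T hT
      simp only [Finset.mem_coe, Fintype.mem_piFinset, Finset.mem_product]
      exact fun i => ⟨hbd u hu T hT i, hbd v hv T hT i⟩
    · intro T hT T' hT' heq
      refine subset_sums_injOn G z hz h hT hT' ?_
      have hsum : ∀ S ∈ G.powerset, ∑ k ∈ S, z k =
          ∑ i, c i * (((∑ k ∈ S, u k i : ℤ) : ℂ) + ((∑ k ∈ S, v k i : ℤ) : ℂ) * Complex.I) := by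
        intro S hS
        rw [Finset.sum_congr rfl fun k hk => hzc k (Finset.mem_powerset.mp hS hk),
          Finset.sum_comm]
        refine Finset.sum_congr rfl fun i _ => ?_
        push_cast
        rw [Finset.sum_mul, ← Finset.sum_add_distrib, Finset.mul_sum]
      simp only
      rw [hsum T hT, hsum T' hT']
      refine Finset.sum_congr rfl fun i _ => ?_
      have := congrFun heq i
      simp only [Prod.mk.injEq] at this
      rw [this.1, this.2]
  rw [Finset.card_powerset, Fintype.card_piFinset] at hcard
  simp only [Finset.card_product, hI, Finset.prod_const, Finset.card_univ, Fintype.card_fin]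
    at hcard
  rwa [pow_mul, sq]

/-! ### Binomial weights near the mean -/

/-- The weight of `k` under the binomial distribution with parameters `n` and `p`. -/
def binomWeight (n : ℕ) (p : ℝ) (k : ℕ) : ℝ := n.choose k * p ^ k * (1 - p) ^ (n - k)

theorem binomWeight_nonneg (n : ℕ) {p : ℝ} (hp0 : 0 < p) (hp1 : p < 1) (k : ℕ) :
    0 ≤ binomWeight n p k := by
  have : 0 < 1 - p := by linarith
  unfold binomWeight; positivity

theorem sum_binomWeight (n : ℕ) (p : ℝ) : ∑ k ∈ Finset.range (n + 1), binomWeight n p k = 1 := by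
  have h := (add_pow p (1 - p) n).symm
  rw [add_sub_cancel, one_pow] at h
  rw [← h]
  exact Finset.sum_congr rfl fun k _ => by unfold binomWeight; ring

theorem binomWeight_variance (n : ℕ) (p : ℝ) :
    ∑ k ∈ Finset.range (n + 1), (n * p - k) ^ 2 * binomWeight n p k = n * p * (1 - p) := by
  have h := congrArg (Polynomial.eval p) (bernsteinPolynomial.variance ℝ n)
  rw [Polynomial.eval_finsetSum] at h
  simp [bernsteinPolynomial] at h
  rw [← h]
  exact Finset.sum_congr rfl fun k _ => by unfold binomWeight; ring

theorem binomWeight_succ (n k : ℕ) (hk : k + 1 ≤ n) (p : ℝ) :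
    binomWeight n p (k + 1) * ((k + 1) * (1 - p)) = binomWeight n p k * ((n - k) * p) := by
  have h1 : ((n.choose (k + 1) : ℝ)) * (k + 1) = n.choose k * (n - k) := by
    have := Nat.choose_succ_right_eq n k
    have h2 : ((n - k : ℕ) : ℝ) = n - k := Nat.cast_sub (by omega)
    rw [← h2]; exact_mod_cast this
  have h3 : (1 - p) ^ (n - k) = (1 - p) ^ (n - (k + 1)) * (1 - p) := by
    rw [← pow_succ]; congr 1; omega
  unfold binomWeight
  rw [h3, pow_succ]
  linear_combination (p ^ k * p * (1 - p) ^ (n - (k + 1)) * (1 - p)) * h1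

/-- Some level within `s` of the mean has weight at least `1 / (8 s)`. -/
theorem exists_heavy_level {n s : ℕ} (hs : n ≤ s ^ 2) (hs1 : 1 ≤ s) {p : ℝ} (hp0 : 0 < p)
    (hp1 : p < 1) :
    ∃ k ≤ n, |(n : ℝ) * p - k| ≤ s ∧ 1 / (8 * (s : ℝ)) ≤ binomWeight n p k := by
  -- Otherwise the at most `2s + 1 ≤ 3s` levels within `s` of the mean weigh at most `3/8` together,
  -- and by Chebyshev, with variance at most `s²/4`, the others weigh at most `1/4`. The total would
  -- be below 1.
  by_contra! hcon
  have hs0 : (1 : ℝ) ≤ s := by exact_mod_cast hs1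
  have hw := fun k => binomWeight_nonneg n hp0 hp1 k
  classical
  set A := (Finset.range (n + 1)).filter fun k : ℕ => |(n : ℝ) * p - k| ≤ s with hA
  have hin : ∑ k ∈ A, binomWeight n p k ≤ 3 / 8 := by
    have hcard : (A.card : ℝ) ≤ 3 * s := by
      have hsub : A ⊆ Finset.Icc (⌈(n : ℝ) * p - s⌉₊) (⌈(n : ℝ) * p - s⌉₊ + 2 * s) := by
        intro k hk
        have h1 := (Finset.mem_filter.mp hk).2
        rw [abs_le] at h1
        have h2 := Nat.le_ceil ((n : ℝ) * p - s)
        rw [Finset.mem_Icc]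
        constructor
        · exact Nat.ceil_le.mpr (by linarith)
        · have : (k : ℝ) ≤ ((⌈(n : ℝ) * p - s⌉₊ + 2 * s : ℕ) : ℝ) := by push_cast; linarith
          exact_mod_cast this
      have h2 := Finset.card_le_card hsub
      rw [Nat.card_Icc] at h2
      have h3 : A.card ≤ 3 * s := by omega
      exact_mod_cast h3
    calc ∑ k ∈ A, binomWeight n p k ≤ ∑ k ∈ A, 1 / (8 * (s : ℝ)) := by
          refine Finset.sum_le_sum fun k hk => ?_
          have hk' := Finset.mem_filter.mp hk
          exact (hcon k (by have := Finset.mem_range.mp hk'.1; omega) hk'.2).le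
      _ = A.card * (1 / (8 * (s : ℝ))) := by simp
      _ ≤ 3 * s * (1 / (8 * (s : ℝ))) := by gcongr
      _ = 3 / 8 := by field_simp
  have hout : ∑ k ∈ (Finset.range (n + 1)).filter (fun k : ℕ => ¬ |(n : ℝ) * p - k| ≤ s),
      binomWeight n p k ≤ 1 / 4 := by
    have h1 : ∑ k ∈ (Finset.range (n + 1)).filter (fun k : ℕ => ¬ |(n : ℝ) * p - k| ≤ s),
        (s : ℝ) ^ 2 * binomWeight n p k ≤ n * p * (1 - p) := by
      rw [← binomWeight_variance]
      refine (Finset.sum_le_sum fun k hk => ?_).trans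
        (Finset.sum_le_sum_of_subset_of_nonneg (Finset.filter_subset _ _)
          fun k _ _ => mul_nonneg (sq_nonneg _) (hw k))
      refine mul_le_mul_of_nonneg_right ?_ (hw k)
      have := (Finset.mem_filter.mp hk).2
      rw [← sq_abs ((n : ℝ) * p - k)]
      exact pow_le_pow_left₀ (by linarith) (not_le.mp this).le 2
    rw [← Finset.mul_sum] at h1
    have h2 : (n : ℝ) ≤ s ^ 2 := by exact_mod_cast hs
    have h3 : (n : ℝ) * p * (1 - p) ≤ s ^ 2 * (1 / 4) := by
      have : p * (1 - p) ≤ 1 / 4 := by nlinarith [sq_nonneg (p - 1 / 2)]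
      have hn : (0 : ℝ) ≤ n := Nat.cast_nonneg _
      nlinarith
    exact le_of_mul_le_mul_left (h1.trans h3) (by positivity)
  have htot := sum_binomWeight n p
  rw [← Finset.sum_filter_add_sum_filter_not _ (fun k : ℕ => |(n : ℝ) * p - k| ≤ s)] at htot
  linarith

theorem exp_neg_two_mul_le {x : ℝ} (h0 : 0 ≤ x) (h : x ≤ 1 / 2) : Real.exp (-(2 * x)) ≤ 1 - x := by
  rw [Real.exp_neg, inv_le_comm₀ (Real.exp_pos _) (by linarith)]
  refine le_trans ?_ (Real.add_one_le_exp _)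
  rw [inv_le_iff_one_le_mul₀ (by linarith)]
  nlinarith

/-- Near the mean the weights decay slowly to the left. -/
theorem binomWeight_decay {n s : ℕ} (hs4 : s ^ 2 ≤ 4 * n) (hs1 : 1 ≤ s) {p B : ℝ}
    (hp0 : 0 < p) (hp1 : p < 1) (hB : B * (p * (1 - p)) = 24) (hBs : 2 * B ≤ s) {k : ℕ}
    (hk : k + 1 ≤ n) (hlow : (n : ℝ) * p - 5 * s ≤ k + 1) :
    Real.exp (-(2 * (B / s))) * binomWeight n p (k + 1) ≤ binomWeight n p k := by
  have hq : 0 < 1 - p := by linarith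
  have hpq : 0 < p * (1 - p) := mul_pos hp0 hq
  have hB0 : 0 < B := by
    by_contra hb
    nlinarith [mul_nonneg (neg_nonneg.mpr (not_lt.mp hb)) hpq.le]
  have hs0 : (1 : ℝ) ≤ s := by exact_mod_cast hs1
  have hspos : (0 : ℝ) < s := by linarith
  have hx : B / s ≤ 1 / 2 := by rw [div_le_iff₀ hspos]; linarith
  have hexp := exp_neg_two_mul_le (by positivity) hx
  have hw := binomWeight_nonneg n hp0 hp1 (k + 1)
  refine (mul_le_mul_of_nonneg_right hexp hw).trans ?_
  have hnk : (0 : ℝ) < (n : ℝ) - k := by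
    have : ((k + 1 : ℕ) : ℝ) ≤ n := by exact_mod_cast hk
    push_cast at this; linarith
  have hpos : 0 < ((n : ℝ) - k) * p := mul_pos hnk hp0
  refine le_of_mul_le_mul_right ?_ hpos
  rw [← binomWeight_succ n k hk p, mul_comm (1 - B / s), mul_assoc]
  refine mul_le_mul_of_nonneg_left ?_ hw
  have hs4' : (s : ℝ) ^ 2 ≤ 4 * n := by exact_mod_cast hs4
  -- The 24 in `B` is chosen here: with `s² ≤ 4n` it yields `6s`, which absorbs the error `5s + p`
  -- from being up to `5s` below the mean.
  have hns : 6 * (s : ℝ) ≤ (B / s) * (n * (p * (1 - p))) := by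
    have : (B / s) * (n * (p * (1 - p))) = 24 * n / s := by
      rw [← hB]; ring
    rw [this, le_div_iff₀ hspos]
    nlinarith
  set t := B / s
  have ht : 0 ≤ t := by positivity
  have e1 : (1 - t) * ((n - k) * p) ≤ (1 - t) * ((n * (1 - p) + 5 * s + 1) * p) := by
    refine mul_le_mul_of_nonneg_left ?_ (by linarith)
    refine mul_le_mul_of_nonneg_right ?_ hp0.le
    linarith
  have e2 : (n * p - 5 * s) * (1 - p) ≤ ((k : ℝ) + 1) * (1 - p) :=
    mul_le_mul_of_nonneg_right hlow hq.le
  refine e1.trans (le_trans ?_ e2)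
  have e3 : 0 ≤ t * ((5 * s + 1) * p) := by positivity
  nlinarith

/-- The binomial distribution has `4 s + 1` consecutive levels of weight at least `c / s`, where
`s` is about `√n` and `c` depends on `p` only. -/
theorem exists_heavy_window {p : ℝ} (hp0 : 0 < p) (hp1 : p < 1) :
    ∃ c : ℝ, 0 < c ∧ ∀ n : ℕ, 64 ≤ n → ∃ l : ℕ, l + 4 * (n.sqrt + 1) ≤ n ∧
      ∀ k, l ≤ k → k ≤ l + 4 * (n.sqrt + 1) → c / ((n.sqrt + 1 : ℕ) : ℝ) ≤ binomWeight n p k := by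
  have hq : 0 < 1 - p := by linarith
  have hpq : 0 < p * (1 - p) := mul_pos hp0 hq
  set B : ℝ := 24 / (p * (1 - p)) with hBdef
  have hB : B * (p * (1 - p)) = 24 := by rw [hBdef]; field_simp
  have hB0 : 0 < B := by positivity
  -- For `n ≥ N` one has `s ≥ 2B + 20/p`. The term `2B` is what the decay estimate needs; `20/p`
  -- gives `np ≥ 5s`, so that there is room for `4s` levels to the left of the heavy one.
  set N : ℕ := ⌈(2 * B + 20 / p) ^ 2⌉₊ with hN
  -- The first constant is a crude bound for the finitely many `n ≤ N`. The second is the heavy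
  -- level's `1/8` times the loss `exp (-2B/s)` per step over `4s` steps.
  refine ⟨min ((p * (1 - p)) ^ N) (Real.exp (-(8 * B)) / 8), by positivity, fun n hn => ?_⟩
  set s := n.sqrt + 1 with hs
  have hs1 : 1 ≤ s := by omega
  have hs0 : (1 : ℝ) ≤ s := by exact_mod_cast hs1
  have hns : n ≤ s ^ 2 := (Nat.lt_succ_sqrt' n).le
  have hsq : n.sqrt ^ 2 ≤ n := Nat.sqrt_le' n
  have hsq8 : 8 ≤ n.sqrt := by rw [Nat.le_sqrt]; omega
  have hs4 : s ^ 2 ≤ 4 * n := by rw [hs]; nlinarith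
  rcases le_total n N with hnN | hnN
  · refine ⟨0, by rw [hs]; nlinarith, fun k _ hk => ?_⟩
    have hkn : k ≤ n := by rw [hs] at hk; nlinarith
    calc min ((p * (1 - p)) ^ N) (Real.exp (-(8 * B)) / 8) / (s : ℝ)
        ≤ (p * (1 - p)) ^ N / 1 := by
          gcongr
          exact min_le_left _ _
      _ ≤ (p * (1 - p)) ^ n := by
          rw [div_one]
          exact pow_le_pow_of_le_one hpq.le (by nlinarith) hnN
      _ = p ^ n * (1 - p) ^ n := mul_pow _ _ _
      _ ≤ p ^ k * (1 - p) ^ (n - k) := by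
          gcongr ?_ * ?_
          · exact pow_le_pow_of_le_one hp0.le hp1.le hkn
          · exact pow_le_pow_of_le_one hq.le (by linarith) (Nat.sub_le _ _)
      _ ≤ binomWeight n p k := by
          unfold binomWeight
          rw [mul_assoc]
          refine le_mul_of_one_le_left (by positivity) ?_
          exact_mod_cast Nat.choose_pos hkn
  · obtain ⟨k₀, hk₀n, hk₀, hwk₀⟩ := exists_heavy_level hns hs1 hp0 hp1
    have hbig : 2 * B + 20 / p ≤ s := by
      have h1 : (2 * B + 20 / p) ^ 2 ≤ (s : ℝ) ^ 2 := by
        calc (2 * B + 20 / p) ^ 2 ≤ N := Nat.le_ceil _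
          _ ≤ n := by exact_mod_cast hnN
          _ ≤ (s : ℝ) ^ 2 := by exact_mod_cast hns
      exact le_of_sq_le_sq h1 (by linarith)
    have hBs : 2 * B ≤ s := by
      have : 0 < 20 / p := by positivity
      linarith
    have hps : 20 ≤ p * s := by
      have : 20 / p ≤ s := by linarith
      rw [div_le_iff₀ hp0] at this
      linarith
    have hs4' : (s : ℝ) ^ 2 ≤ 4 * n := by exact_mod_cast hs4
    rw [abs_le] at hk₀
    have hk₀s : 4 * s ≤ k₀ := by
      have : (4 * s : ℝ) ≤ k₀ := by nlinarith
      exact_mod_cast this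
    have hdecay : ∀ j ≤ 4 * s, Real.exp (-(2 * (B / s))) ^ j * binomWeight n p k₀ ≤
        binomWeight n p (k₀ - j) := by
      intro j
      induction j with
      | zero => intro _; simp
      | succ j ih =>
        intro hj
        have h1 := ih (by omega)
        have h2 : k₀ - (j + 1) + 1 = k₀ - j := by omega
        have hcast : ((k₀ - (j + 1) : ℕ) : ℝ) + 1 = k₀ - j := by
          have : ((k₀ - (j + 1) : ℕ) : ℝ) = (k₀ : ℝ) - ((j + 1 : ℕ) : ℝ) :=
            Nat.cast_sub (by omega)
          rw [this]; push_cast; ring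
        have hj' : ((j + 1 : ℕ) : ℝ) ≤ ((4 * s : ℕ) : ℝ) := by exact_mod_cast hj
        push_cast at hj'
        -- The `5s` allowed by the decay estimate is `s` for the distance of `k₀` from the mean plus
        -- the `4s` steps taken.
        have h3 := binomWeight_decay (k := k₀ - (j + 1)) hs4 hs1 hp0 hp1 hB hBs
          (by omega) (by rw [hcast]; linarith)
        rw [h2] at h3
        rw [pow_succ', mul_assoc]
        exact (mul_le_mul_of_nonneg_left h1 (Real.exp_pos _).le).trans h3
    refine ⟨k₀ - 4 * s, by omega, fun k hk1 hk2 => ?_⟩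
    have h1 := hdecay (k₀ - k) (by omega)
    rw [Nat.sub_sub_self (by omega)] at h1
    refine le_trans ?_ h1
    have h2 : Real.exp (-(8 * B)) ≤ Real.exp (-(2 * (B / s))) ^ (k₀ - k) := by
      rw [← Real.exp_nat_mul, Real.exp_le_exp]
      have : ((k₀ - k : ℕ) : ℝ) ≤ 4 * s := by
        exact_mod_cast (show k₀ - k ≤ 4 * s by omega)
      have h5 : ((k₀ - k : ℕ) : ℝ) * (2 * (B / s)) ≤ 4 * s * (2 * (B / s)) := by gcongr
      have h6 : 4 * (s : ℝ) * (2 * (B / s)) = 8 * B := by field_simp; ring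
      linarith
    calc min ((p * (1 - p)) ^ N) (Real.exp (-(8 * B)) / 8) / (s : ℝ)
        ≤ Real.exp (-(8 * B)) / 8 / s := by gcongr; exact min_le_right _ _
      _ = Real.exp (-(8 * B)) * (1 / (8 * (s : ℝ))) := by field_simp
      _ ≤ _ := by gcongr

/-! ### Tensor product operators and the Pauli group -/

theorem tensorOp_mul {n : ℕ} (A B : Fin n → Matrix (Fin 2) (Fin 2) ℂ) :
    tensorOp A * tensorOp B = tensorOp fun i => A i * B i := by
  ext x y
  simp only [tensorOp, Matrix.mul_apply, Matrix.of_apply]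
  rw [Finset.prod_univ_sum, Fintype.piFinset_univ]
  exact Finset.sum_congr rfl fun z _ => Finset.prod_mul_distrib.symm

theorem tensorOp_one {n : ℕ} : tensorOp (fun _ : Fin n => (1 : Matrix (Fin 2) (Fin 2) ℂ)) = 1 := by
  ext x y
  simp only [tensorOp, Matrix.of_apply, Matrix.one_apply]
  rw [Finset.prod_ite_zero]
  simp [funext_iff]

theorem tensorOp_conjTranspose {n : ℕ} (A : Fin n → Matrix (Fin 2) (Fin 2) ℂ) :
    (tensorOp A)ᴴ = tensorOp fun i => (A i)ᴴ := by
  ext x y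
  simp [tensorOp, Matrix.conjTranspose_apply]

theorem tensorOp_mem_unitaryGroup {n : ℕ} {A : Fin n → Matrix (Fin 2) (Fin 2) ℂ}
    (hA : ∀ i, A i ∈ Matrix.unitaryGroup (Fin 2) ℂ) :
    tensorOp A ∈ Matrix.unitaryGroup (Bits n) ℂ := by
  rw [Matrix.mem_unitaryGroup_iff, Matrix.star_eq_conjTranspose, tensorOp_conjTranspose,
    tensorOp_mul, ← tensorOp_one]
  congr 1
  funext i
  exact Matrix.mem_unitaryGroup_iff.mp (hA i)

/-- The single-qubit operators whose tensor products generate the Pauli group. -/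
def IsPauliGen (A : Matrix (Fin 2) (Fin 2) ℂ) : Prop :=
  A = 1 ∨ A = pauliX ∨ A = pauliZ ∨ A = Complex.I • 1

theorem IsPauliGen.mem_unitaryGroup {A : Matrix (Fin 2) (Fin 2) ℂ} (hA : IsPauliGen A) :
    A ∈ Matrix.unitaryGroup (Fin 2) ℂ := by
  rw [Matrix.mem_unitaryGroup_iff, Matrix.star_eq_conjTranspose]
  rcases hA with rfl | rfl | rfl | rfl
  · simp
  · ext i j; fin_cases i <;> fin_cases j <;> simp [pauliX, Matrix.mul_apply]
  · ext i j; fin_cases i <;> fin_cases j <;> simp [pauliZ, Matrix.mul_apply]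
  · ext i j; fin_cases i <;> fin_cases j <;> simp [Matrix.mul_apply]

theorem mem_pauliGroup_of_isPauliGen {n : ℕ} {P : Matrix.unitaryGroup (Bits n) ℂ}
    {A : Fin n → Matrix (Fin 2) (Fin 2) ℂ} (hA : ∀ i, IsPauliGen (A i))
    (hP : (P : Matrix (Bits n) (Bits n) ℂ) = tensorOp A) : P ∈ pauliGroup n :=
  Subgroup.subset_closure ⟨A, hA, hP⟩

/-- Pauli matrices have one nonzero entry per row, a fourth root of unity. -/
def IsPauliMonomial {n : ℕ} (P : Matrix (Bits n) (Bits n) ℂ) : Prop :=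
  ∃ (a : Bits n) (f : Bits n → ℂ), (∀ x, f x ^ 4 = 1) ∧ ∀ x y, P x y = if y = x + a then f x else 0

theorem bits_add_add_cancel {n : ℕ} (x a : Bits n) : x + a + a = x := by
  funext i
  simp only [Pi.add_apply]
  generalize x i = u
  generalize a i = v
  revert u v; decide

theorem IsPauliGen.monomial {A : Matrix (Fin 2) (Fin 2) ℂ} (hA : IsPauliGen A) :
    ∃ (a : Fin 2) (f : Fin 2 → ℂ), (∀ x, f x ^ 4 = 1) ∧
      ∀ x y, A x y = if y = x + a then f x else 0 := by
  rcases hA with rfl | rfl | rfl | rfl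
  · refine ⟨0, fun _ => 1, by simp, fun x y => ?_⟩
    fin_cases x <;> fin_cases y <;> simp
  · refine ⟨1, fun _ => 1, by simp, fun x y => ?_⟩
    fin_cases x <;> fin_cases y <;> simp [pauliX]
  · refine ⟨0, ![1, -1], fun x => ?_, fun x y => ?_⟩
    · fin_cases x <;> norm_num
    · fin_cases x <;> fin_cases y <;> simp [pauliZ]
  · refine ⟨0, fun _ => Complex.I, by simp, fun x y => ?_⟩
    fin_cases x <;> fin_cases y <;> simp

theorem isPauliMonomial_of_mem {n : ℕ} {P : Matrix.unitaryGroup (Bits n) ℂ}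
    (hP : P ∈ pauliGroup n) : IsPauliMonomial (P : Matrix (Bits n) (Bits n) ℂ) := by
  induction hP using Subgroup.closure_induction with
  | mem P hP =>
    obtain ⟨A, hA, hPA⟩ := hP
    choose a f hf haf using fun i => IsPauliGen.monomial (hA i)
    refine ⟨a, fun x => ∏ i, f i (x i), fun x => ?_, fun x y => ?_⟩
    · rw [← Finset.prod_pow]; exact Finset.prod_eq_one fun i _ => hf i _
    · rw [hPA]
      simp only [tensorOp, Matrix.of_apply, haf]
      rw [Finset.prod_ite_zero]
      simp [funext_iff]
  | one => exact ⟨0, fun _ => 1, by simp, fun x y => by simp [Matrix.one_apply, eq_comm]⟩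
  | mul P Q _ _ hP hQ =>
    obtain ⟨a, f, hf, haf⟩ := hP
    obtain ⟨b, g, hg, hbg⟩ := hQ
    refine ⟨a + b, fun x => f x * g (x + a), fun x => by rw [mul_pow, hf, hg, one_mul],
      fun x y => ?_⟩
    rw [Submonoid.coe_mul, Matrix.mul_apply]
    rw [Finset.sum_eq_single (x + a)]
    · rw [haf, hbg, if_pos rfl, mul_ite, mul_zero, add_assoc]
    · intro z _ hz; rw [haf, if_neg hz, zero_mul]
    · simp
  | inv P _ hP =>
    obtain ⟨a, f, hf, haf⟩ := hP
    refine ⟨a, fun x => star (f (x + a)), fun x => by rw [← star_pow, hf, star_one],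
      fun x y => ?_⟩
    have h1 : ((P⁻¹ : Matrix.unitaryGroup (Bits n) ℂ) : Matrix (Bits n) (Bits n) ℂ) x y
        = star ((P : Matrix (Bits n) (Bits n) ℂ) y x) := by
      rw [Matrix.UnitaryGroup.inv_val, Matrix.star_apply]
    rw [h1, haf]
    by_cases h : y = x + a
    · subst h; simp [bits_add_add_cancel]
    · have h' : x ≠ y + a := by
        rintro rfl; exact h (bits_add_add_cancel y a).symm
      simp [h, h']

/-! ### Coordinates of stabilizer states -/

/-- The sum factorizes over qubits, and `1 + Z` is twice the projection onto `e_0`. Thus the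
`Z`-type Pauli operators average to the projection onto `e_0^{⊗n}`. -/
theorem sum_tensorOp_zed {n : ℕ} (x y : Bits n) :
    ∑ z : Bits n, tensorOp (fun i => if z i = 0 then 1 else pauliZ) x y
      = if x = 0 ∧ y = 0 then (2 : ℂ) ^ n else 0 := by
  simp only [tensorOp, Matrix.of_apply]
  have h1 : ∀ a b : Fin 2, ∑ j : Fin 2, (if j = 0 then (1 : Matrix (Fin 2) (Fin 2) ℂ) else pauliZ) a b
      = if a = 0 ∧ b = 0 then 2 else 0 := by
    intro a b
    fin_cases a <;> fin_cases b <;> simp [pauliZ]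
    norm_num
  have h2 := Finset.prod_univ_sum (fun _ : Fin n => (Finset.univ : Finset (Fin 2)))
    (fun i j => (if j = 0 then (1 : Matrix (Fin 2) (Fin 2) ℂ) else pauliZ) (x i) (y i))
  rw [Fintype.piFinset_univ] at h2
  rw [← h2]
  simp only [h1]
  rw [Finset.prod_ite_zero]
  simp [funext_iff, forall_and]

theorem ketZero_apply_eq {n : ℕ} (U : Matrix (Bits n) (Bits n) ℂ) (x : Bits n) :
    Matrix.toEuclideanLin U (ketZero n) x = U x 0 := by
  simp only [ketZero, Matrix.toLpLin_apply]
  simp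
  rfl

/-- The first column of a Clifford operator: any two nonzero entries differ by a fourth root of
unity. -/
theorem clifford_column {n : ℕ} {U : Matrix.unitaryGroup (Bits n) ℂ} (hU : U ∈ cliffordGroup n)
    {x y : Bits n} (hx : (U : Matrix (Bits n) (Bits n) ℂ) x 0 ≠ 0)
    (hy : (U : Matrix (Bits n) (Bits n) ℂ) y 0 ≠ 0) :
    ∃ ω : ℂ, ω ^ 4 = 1 ∧ (U : Matrix (Bits n) (Bits n) ℂ) x 0 = ω * (U : Matrix (Bits n) (Bits n) ℂ) y 0 := by
  have hgen : ∀ z : Bits n, ∀ i, IsPauliGen (if z i = 0 then 1 else pauliZ) := by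
    intro z i; split_ifs
    · exact Or.inl rfl
    · exact Or.inr (Or.inr (Or.inl rfl))
  let Q : Bits n → Matrix.unitaryGroup (Bits n) ℂ := fun z =>
    ⟨tensorOp (fun i => if z i = 0 then 1 else pauliZ),
      tensorOp_mem_unitaryGroup fun i => (hgen z i).mem_unitaryGroup⟩
  have hQ : ∀ z, Q z ∈ pauliGroup n := fun z => mem_pauliGroup_of_isPauliGen (hgen z) rfl
  have hsum : ∑ z, ((U * Q z * U⁻¹ : Matrix.unitaryGroup (Bits n) ℂ) : Matrix (Bits n) (Bits n) ℂ)
      = (U : Matrix (Bits n) (Bits n) ℂ) * (∑ z, (Q z : Matrix (Bits n) (Bits n) ℂ))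
        * (U : Matrix (Bits n) (Bits n) ℂ)ᴴ := by
    rw [Finset.mul_sum, Finset.sum_mul]
    rfl
  -- Conjugating the projection onto `e_0^{⊗n}` gives the rank-one operator `u u*` with `u` the
  -- first column of `U`. Its entry at `(x, y)` is nonzero, so some conjugated Pauli operator has a
  -- nonzero entry there.
  have hentry : ∑ z, ((U * Q z * U⁻¹ : Matrix.unitaryGroup (Bits n) ℂ) : Matrix (Bits n) (Bits n) ℂ) x y
      = (U : Matrix (Bits n) (Bits n) ℂ) x 0 * 2 ^ n * star ((U : Matrix (Bits n) (Bits n) ℂ) y 0) := by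
    rw [← Matrix.sum_apply, hsum]
    have hproj : ∀ a b, (∑ z, (Q z : Matrix (Bits n) (Bits n) ℂ)) a b
        = if a = 0 ∧ b = 0 then (2 : ℂ) ^ n else 0 := by
      intro a b
      rw [Matrix.sum_apply]
      exact sum_tensorOp_zed a b
    rw [Matrix.mul_apply, Finset.sum_eq_single 0]
    · rw [Matrix.mul_apply, Finset.sum_eq_single 0]
      · rw [hproj]; simp [Matrix.conjTranspose_apply]
      · intro b _ hb; rw [hproj]; simp [hb]
      · simp
    · intro b _ hb
      rw [Matrix.mul_apply, Finset.sum_eq_zero, zero_mul]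
      intro a _; rw [hproj]; simp [hb]
    · simp
  have hne : ∃ z, ((U * Q z * U⁻¹ : Matrix.unitaryGroup (Bits n) ℂ) :
      Matrix (Bits n) (Bits n) ℂ) x y ≠ 0 := by
    by_contra! h
    rw [Finset.sum_eq_zero fun z _ => h z] at hentry
    have : (U : Matrix (Bits n) (Bits n) ℂ) x 0 * 2 ^ n
        * star ((U : Matrix (Bits n) (Bits n) ℂ) y 0) ≠ 0 := by
      simp [hx, hy]
    exact this hentry.symm
  obtain ⟨z, hz⟩ := hne
  have hmem : U * Q z * U⁻¹ ∈ pauliGroup n :=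
    (Subgroup.mem_normalizer_iff.mp hU (Q z)).mp (hQ z)
  obtain ⟨a, f, hf, haf⟩ := isPauliMonomial_of_mem hmem
  have hya : y = x + a := by
    by_contra h; rw [haf, if_neg h] at hz; exact hz rfl
  refine ⟨f x, hf x, ?_⟩
  -- Since `Q z` fixes `e_0^{⊗n}`, its conjugate fixes the first column of `U`. Being monomial, it
  -- relates the entries at `x` and `y` by a fourth root of unity.
  have h1 : ((U * Q z * U⁻¹ : Matrix.unitaryGroup (Bits n) ℂ) : Matrix (Bits n) (Bits n) ℂ)
      * (U : Matrix (Bits n) (Bits n) ℂ)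
      = (U : Matrix (Bits n) (Bits n) ℂ) * (Q z : Matrix (Bits n) (Bits n) ℂ) := by
    have : U * Q z * U⁻¹ * U = U * Q z := by group
    exact congrArg Subtype.val this
  have h2 := congrFun (congrFun h1 x) 0
  rw [Matrix.mul_apply, Matrix.mul_apply] at h2
  have hQ0 : ∀ b, (Q z : Matrix (Bits n) (Bits n) ℂ) b 0 = if b = 0 then 1 else 0 := by
    intro b
    have h3 : ∀ i, (if z i = 0 then (1 : Matrix (Fin 2) (Fin 2) ℂ) else pauliZ) (b i) 0
        = if b i = 0 then 1 else 0 := by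
      intro i
      generalize b i = c
      by_cases hc : z i = 0
      · rw [if_pos hc, Matrix.one_apply]
      · rw [if_neg hc]; fin_cases c <;> simp [pauliZ]
    change ∏ i, (if z i = 0 then (1 : Matrix (Fin 2) (Fin 2) ℂ) else pauliZ) (b i) 0 = _
    simp only [h3]
    rw [Finset.prod_ite_zero]
    simp [funext_iff]
  simp only [hQ0, haf, ite_mul, zero_mul, mul_ite, mul_one, mul_zero, Finset.sum_ite_eq',
    Finset.mem_univ, if_true] at h2
  rw [hya]; exact h2.symm

theorem exists_int_of_pow_four {ω : ℂ} (h : ω ^ 4 = 1) :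
    ∃ u v : ℤ, |u| ≤ 1 ∧ |v| ≤ 1 ∧ ω = u + v * Complex.I := by
  have h1 : (ω - 1) * ((ω + 1) * ((ω - Complex.I) * (ω + Complex.I))) = 0 := by
    linear_combination h + (1 - ω ^ 2) * Complex.I_sq
  rcases mul_eq_zero.mp h1 with h | h
  · exact ⟨1, 0, by simp, by simp, by simpa using sub_eq_zero.mp h⟩
  rcases mul_eq_zero.mp h with h | h
  · exact ⟨-1, 0, by simp, by simp, by simpa using eq_neg_of_add_eq_zero_left h⟩
  rcases mul_eq_zero.mp h with h | h
  · exact ⟨0, 1, by simp, by simp, by simpa using sub_eq_zero.mp h⟩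
  · exact ⟨0, -1, by simp, by simp, by simpa using eq_neg_of_add_eq_zero_left h⟩

/-- Up to a common factor, the coordinates of a stabilizer state lie in `{0, ±1, ±i}`. -/
theorem stabilizer_coords {n : ℕ} {σ : QSpace n} (hσ : σ ≠ 0)
    (h : Projectivization.mk ℂ σ hσ ∈ stabStates n) :
    ∃ (c : ℂ) (u v : Bits n → ℤ), (∀ x, |u x| ≤ 1) ∧ (∀ x, |v x| ≤ 1) ∧
      ∀ x, σ x = c * ((u x : ℂ) + (v x : ℂ) * Complex.I) := by
  obtain ⟨U, hU, h0, heq⟩ := h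
  obtain ⟨t, ht⟩ := (Projectivization.mk_eq_mk_iff' ℂ _ _ hσ h0).mp heq
  have hcoord : ∀ x, σ x = t * (U : Matrix (Bits n) (Bits n) ℂ) x 0 := by
    intro x
    rw [← ht, PiLp.smul_apply, ketZero_apply_eq, smul_eq_mul]
  obtain ⟨y, hy⟩ : ∃ y, (U : Matrix (Bits n) (Bits n) ℂ) y 0 ≠ 0 := by
    by_contra! hall
    apply hσ
    ext x
    rw [hcoord, hall x, mul_zero, PiLp.zero_apply]
  have hex : ∀ x, ∃ w : ℤ × ℤ, |w.1| ≤ 1 ∧ |w.2| ≤ 1 ∧ (U : Matrix (Bits n) (Bits n) ℂ) x 0 =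
      ((w.1 : ℂ) + (w.2 : ℂ) * Complex.I) * (U : Matrix (Bits n) (Bits n) ℂ) y 0 := by
    intro x
    by_cases hx : (U : Matrix (Bits n) (Bits n) ℂ) x 0 = 0
    · exact ⟨(0, 0), by simp, by simp, by simp [hx]⟩
    · obtain ⟨ω, hω, he⟩ := clifford_column hU hx hy
      obtain ⟨u, v, hu, hv, huv⟩ := exists_int_of_pow_four hω
      exact ⟨(u, v), hu, hv, by rw [he, huv]⟩
  choose w hw1 hw2 hw using hex
  refine ⟨t * (U : Matrix (Bits n) (Bits n) ℂ) y 0, fun x => (w x).1, fun x => (w x).2, hw1, hw2,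
    fun x => ?_⟩
  rw [hcoord, hw x]; ring

/-! ### Local Clifford operators -/

/-- Splitting each conjugated factor into three generators writes the conjugated tensor product as a
product of three generators of the Pauli group. Three are allowed because the phase gate sends `X`
to `i X Z`. -/
theorem conj_mem_pauliGroup {n : ℕ} {U : Matrix.unitaryGroup (Bits n) ℂ}
    {M : Matrix (Fin 2) (Fin 2) ℂ} (hU : (U : Matrix (Bits n) (Bits n) ℂ) = tensorOp fun _ => M)
    (h : ∀ A, IsPauliGen A → ∃ B C D, IsPauliGen B ∧ IsPauliGen C ∧ IsPauliGen D ∧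
      M * A * Mᴴ = B * C * D) {P : Matrix.unitaryGroup (Bits n) ℂ} (hP : P ∈ pauliGroup n) :
    U * P * U⁻¹ ∈ pauliGroup n := by
  induction hP using Subgroup.closure_induction with
  | mem P hP =>
    obtain ⟨A, hA, hPA⟩ := hP
    choose B C D hB hC hD hBCD using fun i => h (A i) (hA i)
    have key : U * P * U⁻¹ =
        (⟨tensorOp B, tensorOp_mem_unitaryGroup fun i => (hB i).mem_unitaryGroup⟩ *
        ⟨tensorOp C, tensorOp_mem_unitaryGroup fun i => (hC i).mem_unitaryGroup⟩ *
        ⟨tensorOp D, tensorOp_mem_unitaryGroup fun i => (hD i).mem_unitaryGroup⟩ :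
        Matrix.unitaryGroup (Bits n) ℂ) := by
      apply Subtype.ext
      change (U : Matrix (Bits n) (Bits n) ℂ) * (P : Matrix (Bits n) (Bits n) ℂ)
        * (U : Matrix (Bits n) (Bits n) ℂ)ᴴ = tensorOp B * tensorOp C * tensorOp D
      rw [hU, hPA, tensorOp_conjTranspose]
      simp only [tensorOp_mul, hBCD]
    rw [key]
    exact mul_mem (mul_mem (mem_pauliGroup_of_isPauliGen hB rfl)
      (mem_pauliGroup_of_isPauliGen hC rfl)) (mem_pauliGroup_of_isPauliGen hD rfl)
  | one => simp
  | mul P Q _ _ hP hQ =>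
    have : U * (P * Q) * U⁻¹ = (U * P * U⁻¹) * (U * Q * U⁻¹) := by group
    rw [this]; exact mul_mem hP hQ
  | inv P _ hP =>
    have : U * P⁻¹ * U⁻¹ = (U * P * U⁻¹)⁻¹ := by group
    rw [this]; exact inv_mem hP

/-- A single-qubit operator all of whose tensor powers are Clifford operators. -/
def IsLocalClifford (M : Matrix (Fin 2) (Fin 2) ℂ) : Prop :=
  ∀ n : ℕ, ∃ U ∈ cliffordGroup n, (U : Matrix (Bits n) (Bits n) ℂ) = tensorOp fun _ => M

theorem IsLocalClifford.mul {M N : Matrix (Fin 2) (Fin 2) ℂ} (hM : IsLocalClifford M)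
    (hN : IsLocalClifford N) : IsLocalClifford (M * N) := by
  intro n
  obtain ⟨U, hU, hUM⟩ := hM n
  obtain ⟨V, hV, hVN⟩ := hN n
  exact ⟨U * V, mul_mem hU hV, by rw [Submonoid.coe_mul, hUM, hVN, tensorOp_mul]⟩

theorem isLocalClifford_one : IsLocalClifford 1 := fun _ =>
  ⟨1, one_mem _, by rw [tensorOp_one]; rfl⟩

/-- Membership in the normalizer is an equivalence, so conjugation by `M` and by its inverse must
both preserve the Pauli group. -/
theorem isLocalClifford_of_conj {M : Matrix (Fin 2) (Fin 2) ℂ}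
    (hM : M ∈ Matrix.unitaryGroup (Fin 2) ℂ)
    (h1 : ∀ A, IsPauliGen A → ∃ B C D, IsPauliGen B ∧ IsPauliGen C ∧ IsPauliGen D ∧
      M * A * Mᴴ = B * C * D)
    (h2 : ∀ A, IsPauliGen A → ∃ B C D, IsPauliGen B ∧ IsPauliGen C ∧ IsPauliGen D ∧
      Mᴴ * A * M = B * C * D) : IsLocalClifford M := by
  intro n
  let U : Matrix.unitaryGroup (Bits n) ℂ := ⟨tensorOp fun _ => M, tensorOp_mem_unitaryGroup fun _ => hM⟩
  refine ⟨U, Subgroup.mem_normalizer_iff.mpr fun P => ⟨fun hP => conj_mem_pauliGroup rfl h1 hP,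
    fun hP => ?_⟩, rfl⟩
  have hU' : ((U⁻¹ : Matrix.unitaryGroup (Bits n) ℂ) : Matrix (Bits n) (Bits n) ℂ)
      = tensorOp fun _ => Mᴴ := tensorOp_conjTranspose _
  have h3 := conj_mem_pauliGroup hU' (by simpa using h2) hP
  have : U⁻¹ * (U * P * U⁻¹) * U⁻¹⁻¹ = P := by group
  rwa [this] at h3

theorem isPauliGen_one : IsPauliGen 1 := Or.inl rfl
theorem isPauliGen_X : IsPauliGen pauliX := Or.inr (Or.inl rfl)
theorem isPauliGen_Z : IsPauliGen pauliZ := Or.inr (Or.inr (Or.inl rfl))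
theorem isPauliGen_I : IsPauliGen (Complex.I • 1) := Or.inr (Or.inr (Or.inr rfl))

theorem isLocalClifford_X : IsLocalClifford pauliX := fun n => by
  let U : Matrix.unitaryGroup (Bits n) ℂ :=
    ⟨tensorOp fun _ => pauliX, tensorOp_mem_unitaryGroup fun _ => isPauliGen_X.mem_unitaryGroup⟩
  exact ⟨U, Subgroup.le_normalizer (mem_pauliGroup_of_isPauliGen (fun _ => isPauliGen_X) rfl), rfl⟩

/-- The Hadamard matrix. -/
noncomputable def hadamard : Matrix (Fin 2) (Fin 2) ℂ :=
  ((Real.sqrt 2 : ℝ) : ℂ)⁻¹ • !![1, 1; 1, -1]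

/-- The phase gate. -/
noncomputable def phaseGate : Matrix (Fin 2) (Fin 2) ℂ := !![1, 0; 0, Complex.I]

theorem inv_sqrt_two_sq : (((Real.sqrt 2 : ℝ) : ℂ)⁻¹) * (((Real.sqrt 2 : ℝ) : ℂ)⁻¹) = 1 / 2 := by
  rw [← mul_inv, ← Complex.ofReal_mul, Real.mul_self_sqrt (by norm_num)]
  norm_num

theorem hadamard_conjTranspose : hadamardᴴ = hadamard := by
  ext i j; fin_cases i <;> fin_cases j <;> simp [hadamard]

theorem hadamard_conj (A : Matrix (Fin 2) (Fin 2) ℂ) :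
    hadamard * A * hadamard = (1 / 2 : ℂ) • (!![1, 1; 1, -1] * A * !![1, 1; 1, -1]) := by
  simp only [hadamard, Matrix.smul_mul, Matrix.mul_smul, smul_smul, inv_sqrt_two_sq]

theorem hadamard_mul_self : hadamard * hadamard = 1 := by
  have := hadamard_conj 1
  rw [mul_one] at this
  rw [this]
  ext i j; fin_cases i <;> fin_cases j <;> simp <;> norm_num

theorem isLocalClifford_hadamard : IsLocalClifford hadamard := by
  have key : ∀ A, IsPauliGen A → ∃ B C D, IsPauliGen B ∧ IsPauliGen C ∧ IsPauliGen D ∧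
      hadamard * A * hadamard = B * C * D := by
    intro A hA
    rcases hA with rfl | rfl | rfl | rfl
    · exact ⟨1, 1, 1, isPauliGen_one, isPauliGen_one, isPauliGen_one, by simp [hadamard_mul_self]⟩
    · refine ⟨pauliZ, 1, 1, isPauliGen_Z, isPauliGen_one, isPauliGen_one, ?_⟩
      rw [hadamard_conj]
      ext i j; fin_cases i <;> fin_cases j <;> simp [pauliX, pauliZ] <;> norm_num
    · refine ⟨pauliX, 1, 1, isPauliGen_X, isPauliGen_one, isPauliGen_one, ?_⟩
      rw [hadamard_conj]
      ext i j; fin_cases i <;> fin_cases j <;> simp [pauliX, pauliZ] <;> norm_num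
    · refine ⟨Complex.I • 1, 1, 1, isPauliGen_I, isPauliGen_one, isPauliGen_one, ?_⟩
      simp [hadamard_mul_self]
  refine isLocalClifford_of_conj ?_ ?_ ?_
  · rw [Matrix.mem_unitaryGroup_iff, Matrix.star_eq_conjTranspose, hadamard_conjTranspose,
      hadamard_mul_self]
  · rwa [hadamard_conjTranspose]
  · rwa [hadamard_conjTranspose]

theorem isLocalClifford_phaseGate : IsLocalClifford phaseGate := by
  have hc : phaseGateᴴ = !![1, 0; 0, -Complex.I] := by
    ext i j; fin_cases i <;> fin_cases j <;> simp [phaseGate]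
  refine isLocalClifford_of_conj ?_ ?_ ?_
  · rw [Matrix.mem_unitaryGroup_iff, Matrix.star_eq_conjTranspose, hc]
    ext i j; fin_cases i <;> fin_cases j <;> simp [phaseGate]
  · intro A hA
    rw [hc]
    rcases hA with rfl | rfl | rfl | rfl
    · refine ⟨1, 1, 1, isPauliGen_one, isPauliGen_one, isPauliGen_one, ?_⟩
      ext i j; fin_cases i <;> fin_cases j <;> simp [phaseGate]
    · refine ⟨Complex.I • 1, pauliX, pauliZ, isPauliGen_I, isPauliGen_X, isPauliGen_Z, ?_⟩
      ext i j; fin_cases i <;> fin_cases j <;> simp [phaseGate, pauliX, pauliZ]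
    · refine ⟨pauliZ, 1, 1, isPauliGen_Z, isPauliGen_one, isPauliGen_one, ?_⟩
      ext i j; fin_cases i <;> fin_cases j <;> simp [phaseGate, pauliZ]
    · refine ⟨Complex.I • 1, 1, 1, isPauliGen_I, isPauliGen_one, isPauliGen_one, ?_⟩
      ext i j; fin_cases i <;> fin_cases j <;> simp [phaseGate]
  · intro A hA
    rw [hc]
    rcases hA with rfl | rfl | rfl | rfl
    · refine ⟨1, 1, 1, isPauliGen_one, isPauliGen_one, isPauliGen_one, ?_⟩
      ext i j; fin_cases i <;> fin_cases j <;> simp [phaseGate]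
    · refine ⟨Complex.I • 1, pauliZ, pauliX, isPauliGen_I, isPauliGen_Z, isPauliGen_X, ?_⟩
      ext i j; fin_cases i <;> fin_cases j <;> simp [phaseGate, pauliX, pauliZ]
    · refine ⟨pauliZ, 1, 1, isPauliGen_Z, isPauliGen_one, isPauliGen_one, ?_⟩
      ext i j; fin_cases i <;> fin_cases j <;> simp [phaseGate, pauliZ]
    · refine ⟨Complex.I • 1, 1, 1, isPauliGen_I, isPauliGen_one, isPauliGen_one, ?_⟩
      ext i j; fin_cases i <;> fin_cases j <;> simp [phaseGate]

theorem normSq_hadamard_mulVec (v : Fin 2 → ℂ) :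
    Complex.normSq ((hadamard *ᵥ v) 0) = Complex.normSq (v 0 + v 1) / 2 ∧
    Complex.normSq ((hadamard *ᵥ v) 1) = Complex.normSq (v 0 - v 1) / 2 := by
  have h2 : Complex.normSq (((Real.sqrt 2 : ℝ) : ℂ)⁻¹) = 1 / 2 := by
    rw [map_inv₀, Complex.normSq_ofReal, Real.mul_self_sqrt (by norm_num)]
    norm_num
  have e0 : (hadamard *ᵥ v) 0 = ((Real.sqrt 2 : ℝ) : ℂ)⁻¹ * (v 0 + v 1) := by
    simp [hadamard, Matrix.mulVec, dotProduct]; ring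
  have e1 : (hadamard *ᵥ v) 1 = ((Real.sqrt 2 : ℝ) : ℂ)⁻¹ * (v 0 - v 1) := by
    simp [hadamard, Matrix.mulVec, dotProduct]; ring
  rw [e0, e1, map_mul, map_mul, h2]
  constructor <;> ring

/-- A local Clifford operator moves any single-qubit vector to one whose first coordinate
dominates. -/
theorem exists_isLocalClifford_dominant (v : Fin 2 → ℂ) :
    ∃ M, IsLocalClifford M ∧
      3 * Complex.normSq ((M *ᵥ v) 1) ≤ Complex.normSq ((M *ᵥ v) 0) := by
  have flip : ∀ M, IsLocalClifford M →
      (3 * Complex.normSq ((M *ᵥ v) 1) ≤ Complex.normSq ((M *ᵥ v) 0) ∨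
        3 * Complex.normSq ((M *ᵥ v) 0) ≤ Complex.normSq ((M *ᵥ v) 1)) →
      ∃ M, IsLocalClifford M ∧
        3 * Complex.normSq ((M *ᵥ v) 1) ≤ Complex.normSq ((M *ᵥ v) 0) := by
    rintro M hM (h | h)
    · exact ⟨M, hM, h⟩
    · refine ⟨pauliX * M, isLocalClifford_X.mul hM, ?_⟩
      rw [← Matrix.mulVec_mulVec]
      generalize M *ᵥ v = w at h ⊢
      simpa [pauliX, Matrix.mulVec, dotProduct] using h
  -- The operators `1`, `H` and `H S` read off the three Bloch components of `v`. If none of them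
  -- helps, each component is less than half of the Bloch length `‖v‖²` in absolute value, but their
  -- squares sum to its square.
  by_contra hcon
  have c1 := fun h => hcon (flip 1 isLocalClifford_one h)
  have c2 := fun h => hcon (flip hadamard isLocalClifford_hadamard h)
  have c3 := fun h => hcon (flip (hadamard * phaseGate)
    (isLocalClifford_hadamard.mul isLocalClifford_phaseGate) h)
  rw [← Matrix.mulVec_mulVec, (normSq_hadamard_mulVec _).1, (normSq_hadamard_mulVec _).2] at c3
  rw [(normSq_hadamard_mulVec _).1, (normSq_hadamard_mulVec _).2] at c2
  have s0 : (phaseGate *ᵥ v) 0 = v 0 := by simp [phaseGate, Matrix.mulVec, dotProduct]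
  have s1 : (phaseGate *ᵥ v) 1 = Complex.I * v 1 := by simp [phaseGate, Matrix.mulVec, dotProduct]
  rw [s0, s1] at c3
  rw [Matrix.one_mulVec] at c1
  replace c1 := not_or.mp c1
  replace c2 := not_or.mp c2
  replace c3 := not_or.mp c3
  simp only [Complex.normSq_apply, Complex.add_re, Complex.add_im, Complex.sub_re, Complex.sub_im,
    Complex.mul_re, Complex.mul_im, Complex.I_re, Complex.I_im, not_le] at c1 c2 c3
  generalize (v 0).re = a at *
  generalize (v 0).im = b at *
  generalize (v 1).re = c at *
  generalize (v 1).im = d at *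
  set N := a * a + b * b + (c * c + d * d) with hN
  have bound : ∀ t : ℝ, 2 * t < N → -N < 2 * t → 4 * t ^ 2 < N ^ 2 := by
    intro t h1 h2; nlinarith
  have hz := bound (a * a + b * b - (c * c + d * d)) (by linarith [c1.1, c1.2])
    (by linarith [c1.1, c1.2])
  have hx := bound (2 * (a * c + b * d)) (by linarith [c2.1, c2.2])
    (by linarith [c2.1, c2.2])
  have hy := bound (2 * (b * c - a * d)) (by linarith [c3.1, c3.2])
    (by linarith [c3.1, c3.2])
  have hsum : (a * a + b * b - (c * c + d * d)) ^ 2 + (2 * (a * c + b * d)) ^ 2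
      + (2 * (b * c - a * d)) ^ 2 = N ^ 2 := by rw [hN]; ring
  linarith [sq_nonneg N]

/-! ### Levels of product vectors and the approximation argument -/

/-- The number of zeros of a bit string. -/
def numZeros {n : ℕ} (x : Bits n) : ℕ := (Finset.univ.filter fun i => x i = 0).card

theorem card_numZeros_eq (n k : ℕ) :
    (Finset.univ.filter fun x : Bits n => numZeros x = k).card = n.choose k := by
  have h : (Finset.powersetCard k (Finset.univ : Finset (Fin n))).card = n.choose k := by simp
  rw [← h]
  refine Finset.card_nbij' (fun x => Finset.univ.filter fun i => x i = 0)
    (fun S i => if i ∈ S then 0 else 1) ?_ ?_ ?_ ?_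
  · intro x hx
    exact Finset.mem_powersetCard.mpr ⟨Finset.subset_univ _, (Finset.mem_filter.mp hx).2⟩
  · intro S hS
    have hS := (Finset.mem_powersetCard.mp hS).2
    refine Finset.mem_filter.mpr ⟨Finset.mem_univ _, ?_⟩
    simpa [numZeros] using hS
  · intro x _
    funext i
    simp only [Finset.mem_filter, Finset.mem_univ, true_and]
    generalize x i = u
    revert u; decide
  · intro S _
    ext i
    simp

theorem norm_prod_coord {n : ℕ} (w : Fin 2 → ℂ) (x : Bits n) :
    ‖∏ i, w (x i)‖ = ‖w 0‖ ^ numZeros x * ‖w 1‖ ^ (n - numZeros x) := by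
  have h1 : ∀ i, ‖w (x i)‖ = if x i = 0 then ‖w 0‖ else ‖w 1‖ := by
    intro i
    generalize x i = u
    fin_cases u <;> simp
  rw [norm_prod, Finset.prod_congr rfl fun i _ => h1 i, Finset.prod_ite, Finset.prod_const,
    Finset.prod_const]
  congr 2
  have := Finset.card_filter_add_card_filter_not (s := (Finset.univ : Finset (Fin n)))
    (fun i => x i = 0)
  rw [Finset.card_univ, Fintype.card_fin] at this
  unfold numZeros
  omega

/-- The squared moduli are constant on strings with `k` zeros, so measuring a product vector
produces a binomial number of zeros. This lets the heavy window speak about amplitudes. -/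
theorem sum_level_normSq (n k : ℕ) (w : Fin 2 → ℂ) (hw : ‖w 0‖ ^ 2 + ‖w 1‖ ^ 2 = 1) :
    ∑ x ∈ Finset.univ.filter (fun x : Bits n => numZeros x = k), ‖∏ i, w (x i)‖ ^ 2
      = binomWeight n (‖w 0‖ ^ 2) k := by
  have h1 : ∀ x ∈ Finset.univ.filter (fun x : Bits n => numZeros x = k),
      ‖∏ i, w (x i)‖ ^ 2 = (‖w 0‖ ^ 2) ^ k * (1 - ‖w 0‖ ^ 2) ^ (n - k) := by
    intro x hx
    rw [norm_prod_coord, (Finset.mem_filter.mp hx).2, ← hw, add_sub_cancel_left]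
    ring
  rw [Finset.sum_congr rfl h1, Finset.sum_const, card_numZeros_eq, nsmul_eq_mul, binomWeight,
    mul_assoc]

/-- A vector close to a product vector, all of whose coordinates are combinations of `r` numbers
with coefficients in `{0, ±1, ±i}`, has large `r`. -/
theorem two_pow_le_of_approx (w : Fin 2 → ℂ) (hw : ‖w 0‖ ^ 2 + ‖w 1‖ ^ 2 = 1) (h1 : w 1 ≠ 0)
    (h3 : 3 * ‖w 1‖ ^ 2 ≤ ‖w 0‖ ^ 2) :
    ∃ δ : ℝ, 0 < δ ∧ ∀ n : ℕ, 64 ≤ n → ∀ (r : ℕ) (φ : Bits n → ℂ) (c : Fin r → ℂ)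
      (u v : Fin r → Bits n → ℤ), (∀ i x, |u i x| ≤ 1) → (∀ i x, |v i x| ≤ 1) →
      (∀ x, φ x = ∑ i, c i * ((u i x : ℂ) + (v i x : ℂ) * Complex.I)) →
      ∑ x, ‖φ x - ∏ i, w (x i)‖ ^ 2 < δ ^ 2 →
      2 ^ (n.sqrt + 1) ≤ (2 * (n.sqrt + 1) + 1) ^ (2 * r) := by
  have hb : 0 < ‖w 1‖ := norm_pos_iff.mpr h1
  have hab : ‖w 1‖ ≤ ‖w 0‖ := by
    refine le_of_sq_le_sq ?_ (norm_nonneg _)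
    nlinarith
  have ha : 0 < ‖w 0‖ := hb.trans_le hab
  obtain ⟨c₀, hc₀, hwin⟩ := exists_heavy_window (p := ‖w 0‖ ^ 2) (by positivity) (by nlinarith)
  -- Relative error above `1/5` throughout a window level costs at least `c₀ / (25 s)` in squared
  -- distance, so with `δ² = c₀ / 25` fewer than `s` levels are bad.
  refine ⟨Real.sqrt c₀ / 5, by positivity, fun n hn r φ c u v hu hv hφ hdist => ?_⟩
  have hδ : (Real.sqrt c₀ / 5) ^ 2 = c₀ / 25 := by
    rw [div_pow, Real.sq_sqrt hc₀.le]; norm_num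
  rw [hδ] at hdist
  obtain ⟨l, hln, hl⟩ := hwin n hn
  set s := n.sqrt + 1 with hs
  have hs0 : (0 : ℝ) < s := by positivity
  classical
  -- Every second level is kept, so that moduli on distinct levels differ by a factor of at least 3;
  -- of these `2s` levels, at least `s` are good.
  set K : Finset ℕ := (Finset.range (2 * s)).image fun j => l + 2 * j with hK
  have hKcard : K.card = 2 * s := by
    rw [hK, Finset.card_image_of_injective _ (fun i j h => by simpa using h), Finset.card_range]
  have hKmem : ∀ k ∈ K, ∃ j < 2 * s, k = l + 2 * j := by
    intro k hk
    obtain ⟨j, hj, rfl⟩ := Finset.mem_image.mp hk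
    exact ⟨j, Finset.mem_range.mp hj, rfl⟩
  let Good : ℕ → Prop := fun k =>
    ∃ x : Bits n, numZeros x = k ∧ ‖φ x - ∏ i, w (x i)‖ ≤ ‖∏ i, w (x i)‖ / 5
  have hbad : (K.filter fun k => ¬ Good k).card ≤ s := by
    set Bd := K.filter fun k => ¬ Good k with hBd
    have hlevel : ∀ k ∈ Bd, c₀ / s / 25 ≤
        ∑ x ∈ Finset.univ.filter (fun x : Bits n => numZeros x = k), ‖φ x - ∏ i, w (x i)‖ ^ 2 := by
      intro k hk
      obtain ⟨hkK, hkG⟩ := Finset.mem_filter.mp hk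
      obtain ⟨j, hj, hkj⟩ := hKmem k hkK
      have h4 := hl k (by omega) (by omega)
      rw [← sum_level_normSq n k w hw] at h4
      calc c₀ / s / 25 ≤ (∑ x ∈ Finset.univ.filter (fun x : Bits n => numZeros x = k),
            ‖∏ i, w (x i)‖ ^ 2) / 25 := by gcongr
        _ = ∑ x ∈ Finset.univ.filter (fun x : Bits n => numZeros x = k),
            (‖∏ i, w (x i)‖ / 5) ^ 2 := by
          rw [Finset.sum_div]
          exact Finset.sum_congr rfl fun x _ => by rw [div_pow]; norm_num
        _ ≤ _ := by
          refine Finset.sum_le_sum fun x hx => ?_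
          have hx' := (Finset.mem_filter.mp hx).2
          have : ‖∏ i, w (x i)‖ / 5 ≤ ‖φ x - ∏ i, w (x i)‖ := by
            by_contra hlt
            exact hkG ⟨x, hx', (not_le.mp hlt).le⟩
          exact pow_le_pow_left₀ (by positivity) this 2
    have h5 : (Bd.card : ℝ) * (c₀ / s / 25) ≤ ∑ x, ‖φ x - ∏ i, w (x i)‖ ^ 2 := by
      calc (Bd.card : ℝ) * (c₀ / s / 25) = ∑ k ∈ Bd, c₀ / s / 25 := by
            rw [Finset.sum_const, nsmul_eq_mul]
        _ ≤ _ := Finset.sum_le_sum hlevel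
        _ = ∑ x ∈ Finset.univ.filter (fun x : Bits n => numZeros x ∈ Bd),
              ‖φ x - ∏ i, w (x i)‖ ^ 2 := by
            rw [← Finset.sum_fiberwise_of_maps_to (s := Finset.univ.filter
              (fun x : Bits n => numZeros x ∈ Bd)) (t := Bd) (g := numZeros)
              (fun x hx => (Finset.mem_filter.mp hx).2)]
            refine Finset.sum_congr rfl fun k hk => Finset.sum_congr ?_ fun _ _ => rfl
            ext x
            simp only [Finset.mem_filter, Finset.mem_univ, true_and]
            exact ⟨fun h => ⟨h ▸ hk, h⟩, fun h => h.2⟩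
        _ ≤ _ := Finset.sum_le_sum_of_subset_of_nonneg (Finset.filter_subset _ _)
            fun _ _ _ => sq_nonneg _
    have h6 : (Bd.card : ℝ) * (c₀ / s / 25) < s * (c₀ / s / 25) := by
      refine h5.trans_lt (hdist.trans_le (le_of_eq ?_))
      field_simp
    have h7 : (Bd.card : ℝ) < s := lt_of_mul_lt_mul_right h6 (by positivity)
    exact_mod_cast h7.le
  have hgood : s ≤ (K.filter Good).card := by
    have := Finset.card_filter_add_card_filter_not (s := K) Good
    omega
  obtain ⟨G, hG, hGcard⟩ := Finset.exists_subset_card_eq hgood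
  have hGK : ∀ k ∈ G, k ∈ K ∧ Good k := fun k hk => Finset.mem_filter.mp (hG hk)
  have hx : ∀ k, ∃ x : Bits n, k ∈ G →
      numZeros x = k ∧ ‖φ x - ∏ i, w (x i)‖ ≤ ‖∏ i, w (x i)‖ / 5 := by
    intro k
    by_cases hk : k ∈ G
    · obtain ⟨x, hx⟩ := (hGK k hk).2
      exact ⟨x, fun _ => hx⟩
    · exact ⟨0, fun h => absurd h hk⟩
  choose X hX using hx
  have hnorm : ∀ k ∈ G, ‖∏ i, w (X k i)‖ = ‖w 0‖ ^ k * ‖w 1‖ ^ (n - k) := by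
    intro k hk
    rw [norm_prod_coord, (hX k hk).1]
  have hlow : ∀ k ∈ G, 4 / 5 * (‖w 0‖ ^ k * ‖w 1‖ ^ (n - k)) ≤ ‖φ (X k)‖ := by
    intro k hk
    have e1 := norm_sub_norm_le (∏ i, w (X k i)) (φ (X k))
    rw [norm_sub_rev] at e1
    have e2 := (hX k hk).2
    rw [hnorm k hk] at e1 e2
    linarith
  have hupp : ∀ k ∈ G, ‖φ (X k)‖ ≤ 6 / 5 * (‖w 0‖ ^ k * ‖w 1‖ ^ (n - k)) := by
    intro k hk
    have e1 := norm_sub_norm_le (φ (X k)) (∏ i, w (X k i))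
    have e2 := (hX k hk).2
    rw [hnorm k hk] at e1 e2
    linarith
  rw [← hGcard]
  refine two_pow_card_le G (fun k => φ (X k)) ?_ ?_ c (fun k i => u i (X k))
    (fun k i => v i (X k)) (fun k i => hu i _) (fun k i => hv i _) (fun k _ => hφ _)
  · intro k hk
    rw [← norm_pos_iff]
    exact lt_of_lt_of_le (by positivity) (hlow k hk)
  · intro j hj k hk hjk
    obtain ⟨j', _, hj'⟩ := hKmem j (hGK j hj).1
    obtain ⟨k', hk'lt, hk'⟩ := hKmem k (hGK k hk).1
    obtain ⟨d, hd⟩ : ∃ d, k = j + 2 + d := ⟨k - (j + 2), by omega⟩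
    have hkn : k ≤ n := by omega
    -- Two additional zeros give the factor 3, and the remaining `d` do not decrease the modulus.
    -- With relative error `1/5`, the identity `3 · 4/5 = 2 · 6/5` leaves exactly the factor 2
    -- required for doubling.
    have key : 3 * (‖w 0‖ ^ j * ‖w 1‖ ^ (n - j)) ≤ ‖w 0‖ ^ k * ‖w 1‖ ^ (n - k) := by
      have e1 : n - j = 2 + d + (n - k) := by omega
      have e2 : ‖w 1‖ ^ d ≤ ‖w 0‖ ^ d := pow_le_pow_left₀ hb.le hab d
      rw [e1, hd, pow_add, pow_add, pow_add, pow_add]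
      calc 3 * (‖w 0‖ ^ j * (‖w 1‖ ^ 2 * ‖w 1‖ ^ d * ‖w 1‖ ^ (n - (j + 2 + d))))
          = ‖w 0‖ ^ j * (3 * ‖w 1‖ ^ 2) * ‖w 1‖ ^ d * ‖w 1‖ ^ (n - (j + 2 + d)) := by ring
        _ ≤ ‖w 0‖ ^ j * ‖w 0‖ ^ 2 * ‖w 0‖ ^ d * ‖w 1‖ ^ (n - (j + 2 + d)) := by gcongr
    have := hupp j hj
    have := hlow k hk
    linarith

/-! ### Clifford action on states, and attainment of the ranks -/

theorem norm_toEuclideanLin_of_unitary {n : ℕ} (U : Matrix.unitaryGroup (Bits n) ℂ) (φ : QSpace n) :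
    ‖Matrix.toEuclideanLin (U : Matrix (Bits n) (Bits n) ℂ) φ‖ = ‖φ‖ := by
  have hU : (U : Matrix (Bits n) (Bits n) ℂ)ᴴ * (U : Matrix (Bits n) (Bits n) ℂ) = 1 :=
    Matrix.mem_unitaryGroup_iff'.mp U.2
  have h : inner ℂ (Matrix.toEuclideanLin (U : Matrix (Bits n) (Bits n) ℂ) φ)
      (Matrix.toEuclideanLin (U : Matrix (Bits n) (Bits n) ℂ) φ) = inner ℂ φ φ := by
    rw [← LinearMap.adjoint_inner_right, ← Matrix.toEuclideanLin_conjTranspose_eq_adjoint]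
    congr 1
    rw [← LinearMap.comp_apply, ← Matrix.toLpLin_mul_same, hU]
    simp
  rw [inner_self_eq_norm_sq_to_K, inner_self_eq_norm_sq_to_K] at h
  have h2 : ‖Matrix.toEuclideanLin (U : Matrix (Bits n) (Bits n) ℂ) φ‖ ^ 2 = ‖φ‖ ^ 2 := by
    exact_mod_cast h
  exact (pow_left_inj₀ (norm_nonneg _) (norm_nonneg _) two_ne_zero).mp h2

theorem toEuclideanLin_ne_zero {n : ℕ} (U : Matrix.unitaryGroup (Bits n) ℂ) {φ : QSpace n}
    (hφ : φ ≠ 0) : Matrix.toEuclideanLin (U : Matrix (Bits n) (Bits n) ℂ) φ ≠ 0 := by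
  rw [← norm_ne_zero_iff, norm_toEuclideanLin_of_unitary]
  exact norm_ne_zero_iff.mpr hφ

theorem toEuclideanLin_mul_apply {n : ℕ} (A B : Matrix (Bits n) (Bits n) ℂ) (φ : QSpace n) :
    Matrix.toEuclideanLin (A * B) φ = Matrix.toEuclideanLin A (Matrix.toEuclideanLin B φ) := by
  rw [← LinearMap.comp_apply, ← Matrix.toLpLin_mul_same]

/-- Clifford operators map stabilizer states to stabilizer states. -/
theorem clifford_mem_stabStates {n : ℕ} {V : Matrix.unitaryGroup (Bits n) ℂ}
    (hV : V ∈ cliffordGroup n) {σ : QSpace n} (hσ : σ ≠ 0)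
    (h : Projectivization.mk ℂ σ hσ ∈ stabStates n) :
    Projectivization.mk ℂ (Matrix.toEuclideanLin (V : Matrix (Bits n) (Bits n) ℂ) σ)
      (toEuclideanLin_ne_zero V hσ) ∈ stabStates n := by
  obtain ⟨U, hU, h0, heq⟩ := h
  obtain ⟨t, ht⟩ := (Projectivization.mk_eq_mk_iff' ℂ _ _ hσ h0).mp heq
  have hmul : Matrix.toEuclideanLin ((V * U : Matrix.unitaryGroup (Bits n) ℂ) :
      Matrix (Bits n) (Bits n) ℂ) (ketZero n) = Matrix.toEuclideanLin (V : Matrix (Bits n) (Bits n) ℂ)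
        (Matrix.toEuclideanLin (U : Matrix (Bits n) (Bits n) ℂ) (ketZero n)) :=
    toEuclideanLin_mul_apply _ _ _
  refine ⟨V * U, mul_mem hV hU, ?_, ?_⟩
  · rw [hmul]; exact toEuclideanLin_ne_zero V h0
  · refine (Projectivization.mk_eq_mk_iff' ℂ _ _ _ _).mpr ⟨t, ?_⟩
    rw [hmul, ← map_smul, ht]

theorem ketZero_ne_zero (n : ℕ) : ketZero n ≠ 0 := by
  intro h
  have := congrArg (fun v : QSpace n => v 0) h
  have h1 : (ketZero n) 0 = 1 := by
    change (EuclideanSpace.single (0 : Bits n) (1 : ℂ)) 0 = 1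
    simp
  simp [h1] at this

theorem ketZero_mem_stabStates (n : ℕ) :
    Projectivization.mk ℂ (ketZero n) (ketZero_ne_zero n) ∈ stabStates n := by
  have h1 : Matrix.toEuclideanLin ((1 : Matrix.unitaryGroup (Bits n) ℂ) :
      Matrix (Bits n) (Bits n) ℂ) (ketZero n) = ketZero n := by
    rw [OneMemClass.coe_one]; simp
  refine ⟨1, one_mem _, by rw [h1]; exact ketZero_ne_zero n, ?_⟩
  simp only [h1]

/-- Computational basis states are stabilizer states. -/
theorem single_mem_stabStates {n : ℕ} (x : Bits n)
    (hx : (EuclideanSpace.single x (1 : ℂ) : QSpace n) ≠ 0) :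
    Projectivization.mk ℂ (EuclideanSpace.single x (1 : ℂ) : QSpace n) hx ∈ stabStates n := by
  have hgen : ∀ i, IsPauliGen (if x i = 0 then 1 else pauliX) := by
    intro i; split_ifs
    · exact isPauliGen_one
    · exact isPauliGen_X
  let U : Matrix.unitaryGroup (Bits n) ℂ := ⟨tensorOp fun i => if x i = 0 then 1 else pauliX,
    tensorOp_mem_unitaryGroup fun i => (hgen i).mem_unitaryGroup⟩
  have hU : U ∈ cliffordGroup n :=
    Subgroup.le_normalizer (mem_pauliGroup_of_isPauliGen hgen rfl)
  have h1 : Matrix.toEuclideanLin (U : Matrix (Bits n) (Bits n) ℂ) (ketZero n)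
      = EuclideanSpace.single x 1 := by
    ext y
    rw [ketZero_apply_eq]
    have h2 : ∀ i, (if x i = 0 then (1 : Matrix (Fin 2) (Fin 2) ℂ) else pauliX) (y i) 0
        = if y i = x i then 1 else 0 := by
      intro i
      generalize x i = a
      generalize y i = b
      fin_cases a <;> fin_cases b <;> simp [pauliX]
      exact Matrix.one_apply_eq (0 : Fin 2)
    change ∏ i, (if x i = 0 then (1 : Matrix (Fin 2) (Fin 2) ℂ) else pauliX) (y i) 0 = _
    simp only [h2]
    rw [Finset.prod_ite_zero]
    simp [funext_iff]
  have h3 := clifford_mem_stabStates hU (ketZero_ne_zero n) (ketZero_mem_stabStates n)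
  simpa only [h1] using h3

/-- The infimum is attained because basis states are stabilizer states and span the space; `sInf` of
an empty set would be the spurious value 0. -/
theorem stabRank_spec {n : ℕ} (s : QState n) :
    ∃ (c : Fin (stabRank s) → ℂ) (σ : Fin (stabRank s) → QSpace n) (hσ : ∀ i, σ i ≠ 0),
      (∀ i, Projectivization.mk ℂ (σ i) (hσ i) ∈ stabStates n) ∧ s.rep = ∑ i, c i • σ i := by
  refine Nat.sInf_mem (s := {r : ℕ | ∃ (c : Fin r → ℂ) (σ : Fin r → QSpace n) (hσ : ∀ i, σ i ≠ 0),
    (∀ i, Projectivization.mk ℂ (σ i) (hσ i) ∈ stabStates n) ∧ s.rep = ∑ i, c i • σ i}) ?_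
  let e := Fintype.equivFin (Bits n)
  have hne : ∀ x : Bits n, (EuclideanSpace.single x (1 : ℂ) : QSpace n) ≠ 0 := fun x => by simp
  refine ⟨Fintype.card (Bits n), fun i => s.rep (e.symm i),
    fun i => EuclideanSpace.single (e.symm i) 1, fun i => hne _,
    fun i => single_mem_stabStates _ _, ?_⟩
  rw [Equiv.sum_comp e.symm (fun x => s.rep x • (EuclideanSpace.single x (1 : ℂ) : QSpace n))]
  ext y
  simp [Pi.single_apply]

/-- The state itself is an admissible approximation, so the infimum is over a nonempty set and is
attained. -/
theorem approxStabRank_spec {n : ℕ} {δ : ℝ} (hδ : 0 < δ) (s : QState n) :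
    ∃ (φ : QSpace n) (hφ : φ ≠ 0),
      ‖((‖φ‖⁻¹ : ℝ) : ℂ) • φ - ((‖s.rep‖⁻¹ : ℝ) : ℂ) • s.rep‖ < δ ∧
        stabRank (Projectivization.mk ℂ φ hφ) = approxStabRank δ s := by
  refine Nat.sInf_mem (s := {r : ℕ | ∃ (φ : QSpace n) (hφ : φ ≠ 0),
    ‖((‖φ‖⁻¹ : ℝ) : ℂ) • φ - ((‖s.rep‖⁻¹ : ℝ) : ℂ) • s.rep‖ < δ ∧
      stabRank (Projectivization.mk ℂ φ hφ) = r}) ?_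
  exact ⟨_, s.rep, s.rep_nonzero, by simpa using hδ, rfl⟩

theorem stabRank_pos {n : ℕ} (s : QState n) : 0 < stabRank s := by
  obtain ⟨c, σ, _, _, h⟩ := stabRank_spec s
  rw [Nat.pos_iff_ne_zero]
  intro h0
  refine s.rep_nonzero ?_
  rw [h]
  refine Finset.sum_eq_zero fun i _ => ?_
  exact absurd i.2 (by omega)

theorem tensorOp_tensorPow {n : ℕ} (M : Matrix (Fin 2) (Fin 2) ℂ) (ψ : QSpace 1) (x : Bits n) :
    Matrix.toEuclideanLin (tensorOp fun _ => M) (tensorPow n ψ) x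
      = ∏ i, (M *ᵥ fun j => ψ fun _ => j) (x i) := by
  have h1 : Matrix.toEuclideanLin (tensorOp fun _ => M) (tensorPow n ψ) x
      = ∑ y : Bits n, (∏ i, M (x i) (y i)) * ∏ i, ψ fun _ => y i := by
    rw [Matrix.toLpLin_apply]; rfl
  rw [h1]
  simp only [Matrix.mulVec, dotProduct]
  rw [Finset.prod_univ_sum, Fintype.piFinset_univ]
  exact Finset.sum_congr rfl fun y _ => Finset.prod_mul_distrib.symm

theorem tensorPow_one (ψ : QSpace 1) : tensorPow 1 ψ = ψ := by
  ext x
  have : x = fun _ => x 0 := by funext j; rw [Subsingleton.elim j 0]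
  simp only [tensorPow, Finset.univ_unique, Finset.prod_singleton]
  conv_rhs => rw [this]
  rfl

/-- A single-qubit vector that a local Clifford operator maps to a multiple of `e₀` is a
stabilizer state. -/
theorem mem_stabStates_of_isLocalClifford {ψ : QSpace 1} (hψ : ψ ≠ 0)
    {M : Matrix (Fin 2) (Fin 2) ℂ} (hM : IsLocalClifford M)
    (h : (M *ᵥ fun j => ψ fun _ => j) 1 = 0) : Projectivization.mk ℂ ψ hψ ∈ stabStates 1 := by
  obtain ⟨U, hU, hUM⟩ := hM 1
  set t := (M *ᵥ fun j => ψ fun _ => j) 0 with ht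
  have h1 : Matrix.toEuclideanLin (U : Matrix (Bits 1) (Bits 1) ℂ) ψ = t • ketZero 1 := by
    ext x
    rw [hUM]
    conv_lhs => rw [← tensorPow_one ψ]
    rw [tensorOp_tensorPow, PiLp.smul_apply, Finset.univ_unique, Finset.prod_singleton]
    have hk : ketZero 1 x = if x 0 = 0 then 1 else 0 := by
      change (EuclideanSpace.single (0 : Bits 1) (1 : ℂ)) x = _
      simp [funext_iff]
    rw [hk, Fin.default_eq_zero]
    generalize x 0 = u
    fin_cases u
    · simp [ht]
    · simpa using h
  have h2 : Matrix.toEuclideanLin ((U⁻¹ : Matrix.unitaryGroup (Bits 1) ℂ) :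
      Matrix (Bits 1) (Bits 1) ℂ) (Matrix.toEuclideanLin (U : Matrix (Bits 1) (Bits 1) ℂ) ψ) = ψ := by
    rw [← toEuclideanLin_mul_apply, ← Submonoid.coe_mul, inv_mul_cancel, OneMemClass.coe_one]
    simp
  refine ⟨U⁻¹, inv_mem hU, toEuclideanLin_ne_zero _ (ketZero_ne_zero 1), ?_⟩
  refine (Projectivization.mk_eq_mk_iff' ℂ _ _ _ _).mpr ⟨t, ?_⟩
  rw [← map_smul, ← h1, h2]

/-! ### Numerical estimates and conclusion -/

/-- For such `n` the claimed lower bound is at most 1, so positivity of the rank suffices. -/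
theorem sqrt_le_two_mul_logb {n : ℕ} (h2 : 2 ≤ n) (h64 : n < 64) :
    Real.sqrt n ≤ 2 * Real.logb 2 n := by
  have hn : (0 : ℝ) < n := by positivity
  have key : ∀ k : ℕ, 2 ^ k ≤ n → (n : ℝ) ≤ (2 * k : ℝ) ^ 2 → Real.sqrt n ≤ 2 * Real.logb 2 n := by
    intro k hk1 hk2
    have e1 : Real.sqrt n ≤ 2 * k := Real.sqrt_le_iff.mpr ⟨by positivity, hk2⟩
    have e2 : (k : ℝ) ≤ Real.logb 2 n := by
      rw [Real.le_logb_iff_rpow_le (by norm_num) hn, Real.rpow_natCast]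
      exact_mod_cast hk1
    linarith
  -- The ranges `2^k ≤ n ≤ 4k²` for `k = 1, 2, 4` are `[2, 4]`, `[4, 16]` and `[16, 64]`.
  rcases lt_or_ge n 4 with h | h
  · exact key 1 (by omega) (by
      have : (n : ℝ) ≤ 4 := by exact_mod_cast h.le
      norm_num; linarith)
  rcases lt_or_ge n 16 with h' | h'
  · exact key 2 (by omega) (by
      have : (n : ℝ) ≤ 16 := by exact_mod_cast h'.le
      norm_num; linarith)
  · exact key 4 (by omega) (by
      have : (n : ℝ) ≤ 64 := by exact_mod_cast h64.le
      norm_num; linarith)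

/-- For `n ≥ 64` the base `2(⌊√n⌋ + 1) + 1` is at most `n`; taking logarithms gives `√n ≤ 2 r log₂
n`. -/
theorem sqrt_div_logb_le {n r : ℕ} (hn : 64 ≤ n)
    (h : 2 ^ (n.sqrt + 1) ≤ (2 * (n.sqrt + 1) + 1) ^ (2 * r)) :
    Real.sqrt n / (2 * Real.logb 2 n) ≤ r := by
  have hn0 : (1 : ℝ) < n := by exact_mod_cast (by omega : 1 < n)
  have hlog : 0 < Real.logb 2 n := Real.logb_pos (by norm_num) hn0
  have h8 : 8 ≤ n.sqrt := by rw [Nat.le_sqrt]; omega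
  have hsq : n.sqrt ^ 2 ≤ n := Nat.sqrt_le' n
  have h1 : 2 ^ (n.sqrt + 1) ≤ n ^ (2 * r) :=
    h.trans (Nat.pow_le_pow_left (by nlinarith) _)
  have h2 : ((n.sqrt + 1 : ℕ) : ℝ) ≤ Real.logb 2 ((n : ℝ) ^ (2 * r)) := by
    rw [Real.le_logb_iff_rpow_le (by norm_num) (by positivity), Real.rpow_natCast]
    exact_mod_cast h1
  rw [Real.logb_pow] at h2
  have h3 : Real.sqrt n ≤ ((n.sqrt + 1 : ℕ) : ℝ) := by
    refine Real.sqrt_le_iff.mpr ⟨by positivity, ?_⟩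
    exact_mod_cast (Nat.lt_succ_sqrt' n).le
  rw [div_le_iff₀ (by positivity)]
  push_cast at h2 h3
  linarith

/-- The coordinate bound `hcore` for vectors near `w ⊗ ⋯ ⊗ w` bounds the stabilizer rank of every
state close to a vector that a Clifford operator maps to a phase times `w ⊗ ⋯ ⊗ w`. -/
theorem stabRank_lower_bound_of_close {δ : ℝ} {n : ℕ} {w : Fin 2 → ℂ}
    (hcore : ∀ (r : ℕ) (φ : Bits n → ℂ) (c : Fin r → ℂ)
      (u v : Fin r → Bits n → ℤ), (∀ i x, |u i x| ≤ 1) → (∀ i x, |v i x| ≤ 1) →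
      (∀ x, φ x = ∑ i, c i * ((u i x : ℂ) + (v i x : ℂ) * Complex.I)) →
      ∑ x, ‖φ x - ∏ i, w (x i)‖ ^ 2 < δ ^ 2 →
      2 ^ (n.sqrt + 1) ≤ (2 * (n.sqrt + 1) + 1) ^ (2 * r))
    {U : Matrix.unitaryGroup (Bits n) ℂ} (hU : U ∈ cliffordGroup n) {ψ φ : QSpace n} {ζ : ℂ}
    (hζ : ‖ζ‖ = 1)
    (hψ : ∀ x, Matrix.toEuclideanLin (U : Matrix (Bits n) (Bits n) ℂ) ψ x = ζ * ∏ i, w (x i))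
    (hφ : φ ≠ 0) (hclose : ‖((‖φ‖⁻¹ : ℝ) : ℂ) • φ - ψ‖ < δ) :
    2 ^ (n.sqrt + 1) ≤ (2 * (n.sqrt + 1) + 1) ^ (2 * stabRank (Projectivization.mk ℂ φ hφ)) := by
  obtain ⟨c, σ, hσ, hστ, hrep⟩ := stabRank_spec (Projectivization.mk ℂ φ hφ)
  have hζ0 : ζ ≠ 0 := by rw [← norm_ne_zero_iff, hζ]; exact one_ne_zero
  obtain ⟨t, ht⟩ := (Projectivization.mk_eq_mk_iff' ℂ φ _ hφ
    (Projectivization.mk ℂ φ hφ).rep_nonzero).mp (Projectivization.mk_rep _).symm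
  choose d u v hu hv hd using fun i =>
    stabilizer_coords (toEuclideanLin_ne_zero U (hσ i)) (clifford_mem_stabStates hU (hσ i) (hστ i))
  -- The bound is applied to the normalized `φ`, moved by `U` and with the phase `ζ` removed. All
  -- scalars go into the `r` coefficients, which are arbitrary complex numbers.
  refine hcore _ (fun x => ζ⁻¹ * Matrix.toEuclideanLin (U : Matrix (Bits n) (Bits n) ℂ)
    (((‖φ‖⁻¹ : ℝ) : ℂ) • φ) x) (fun i => ζ⁻¹ * ((‖φ‖⁻¹ : ℝ) : ℂ) * t * c i * d i) u v hu hv ?_ ?_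
  · intro x
    have h1 : Matrix.toEuclideanLin (U : Matrix (Bits n) (Bits n) ℂ) (((‖φ‖⁻¹ : ℝ) : ℂ) • φ) x
        = ((‖φ‖⁻¹ : ℝ) : ℂ) * (t * ∑ i, c i *
          Matrix.toEuclideanLin (U : Matrix (Bits n) (Bits n) ℂ) (σ i) x) := by
      generalize ((‖φ‖⁻¹ : ℝ) : ℂ) = κ
      conv_lhs => rw [map_smul, ← ht, hrep, map_smul, map_sum]
      simp only [map_smul, PiLp.smul_apply, smul_eq_mul, WithLp.ofLp_sum, Finset.sum_apply]
    simp only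
    rw [h1, Finset.mul_sum, Finset.mul_sum, Finset.mul_sum]
    refine Finset.sum_congr rfl fun i _ => ?_
    rw [hd i x]; ring
  · have h2 : ∀ x : Bits n, ‖ζ⁻¹ * Matrix.toEuclideanLin (U : Matrix (Bits n) (Bits n) ℂ)
        (((‖φ‖⁻¹ : ℝ) : ℂ) • φ) x - ∏ i, w (x i)‖ ^ 2
        = ‖Matrix.toEuclideanLin (U : Matrix (Bits n) (Bits n) ℂ)
          (((‖φ‖⁻¹ : ℝ) : ℂ) • φ - ψ) x‖ ^ 2 := by
      intro x
      have h3 : ∏ i, w (x i) = ζ⁻¹ * Matrix.toEuclideanLin (U : Matrix (Bits n) (Bits n) ℂ) ψ x := by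
        rw [hψ, inv_mul_cancel_left₀ hζ0]
      rw [h3, ← mul_sub, norm_mul, norm_inv, hζ, inv_one, one_mul, map_sub, PiLp.sub_apply]
    rw [Finset.sum_congr rfl fun x _ => h2 x, ← EuclideanSpace.norm_sq_eq,
      norm_toEuclideanLin_of_unitary]
    exact pow_lt_pow_left₀ hclose (norm_nonneg _) two_ne_zero

theorem sum_norm_prod_sq {n : ℕ} (w : Fin 2 → ℂ) (hw : ‖w 0‖ ^ 2 + ‖w 1‖ ^ 2 = 1) :
    ∑ x : Bits n, ‖∏ i, w (x i)‖ ^ 2 = 1 := by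
  have h := Finset.prod_univ_sum (fun _ : Fin n => (Finset.univ : Finset (Fin 2)))
    (fun _ j => ‖w j‖ ^ 2)
  rw [Fintype.piFinset_univ] at h
  simp only [Fin.sum_univ_two, hw, Finset.prod_const_one] at h
  rw [h]
  exact Finset.sum_congr rfl fun x _ => by rw [norm_prod, Finset.prod_pow]

end StabRank

theorem mainTheorem3 (ψ : StabRank.QSpace 1) (hψ : ψ ≠ 0)
    (hns : Projectivization.mk ℂ ψ hψ ∉ StabRank.stabStates 1) :
    ∃ δ : ℝ, 0 < δ ∧ ∀ n : ℕ, 2 ≤ n →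
      Real.sqrt n / (2 * Real.logb 2 n) ≤
        (StabRank.approxStabRank δ
          (Projectivization.mk ℂ (StabRank.tensorPow n ψ)
            (StabRank.tensorPow_ne_zero n hψ)) : ℝ) := by
  obtain ⟨M, hM, hdom⟩ := StabRank.exists_isLocalClifford_dominant fun j => ψ fun _ => j
  -- Only here is it used that `[ψ]` is not a stabilizer state.
  have hv1 : (M *ᵥ fun j => ψ fun _ => j) 1 ≠ 0 := fun h =>
    hns (StabRank.mem_stabStates_of_isLocalClifford hψ hM h)
  set v := M *ᵥ fun j => ψ fun _ => j with hv
  rw [Complex.normSq_eq_norm_sq, Complex.normSq_eq_norm_sq] at hdom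
  have hv1' : 0 < ‖v 1‖ := norm_pos_iff.mpr hv1
  set N : ℝ := Real.sqrt (‖v 0‖ ^ 2 + ‖v 1‖ ^ 2) with hN
  have hN2 : N ^ 2 = ‖v 0‖ ^ 2 + ‖v 1‖ ^ 2 := Real.sq_sqrt (by positivity)
  have hN0 : 0 < N := Real.sqrt_pos.mpr (by positivity)
  have hNc : (N : ℂ) ≠ 0 := by exact_mod_cast hN0.ne'
  let w : Fin 2 → ℂ := fun j => v j / N
  have hwn : ∀ j, ‖w j‖ ^ 2 = ‖v j‖ ^ 2 / N ^ 2 := fun j => by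
    simp only [w, norm_div, Complex.norm_real, Real.norm_eq_abs, div_pow, sq_abs]
  have hw : ‖w 0‖ ^ 2 + ‖w 1‖ ^ 2 = 1 := by
    rw [hwn, hwn, ← add_div, ← hN2, div_self (by positivity)]
  obtain ⟨δ, hδ, hcore⟩ := StabRank.two_pow_le_of_approx w hw (div_ne_zero hv1 hNc) (by
    rw [hwn, hwn, ← mul_div_assoc]; gcongr)
  refine ⟨δ, hδ, fun n hn => ?_⟩
  set s := Projectivization.mk ℂ (StabRank.tensorPow n ψ) (StabRank.tensorPow_ne_zero n hψ) with hs
  obtain ⟨φ, hφ, hclose, hrank⟩ := StabRank.approxStabRank_spec hδ s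
  rw [← hrank]
  rcases lt_or_ge n 64 with h64 | h64
  · have h1 : (1 : ℝ) ≤ StabRank.stabRank (Projectivization.mk ℂ φ hφ) := by
      exact_mod_cast StabRank.stabRank_pos _
    refine le_trans (div_le_one_of_le₀ (StabRank.sqrt_le_two_mul_logb hn h64) ?_) h1
    exact mul_nonneg zero_le_two (Real.logb_nonneg (by norm_num) (by exact_mod_cast (by omega : 1 ≤ n)))
  · refine StabRank.sqrt_div_logb_le h64 ?_
    obtain ⟨U, hU, hUM⟩ := hM n
    obtain ⟨t, ht⟩ := (Projectivization.mk_eq_mk_iff' ℂ s.rep _ s.rep_nonzero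
      (StabRank.tensorPow_ne_zero n hψ)).mp (Projectivization.mk_rep s)
    -- `s.rep` is an arbitrary representative, so normalizing it fixes `ψ^{⊗n}` only up to a phase.
    -- `ζ` collects this phase and the rescaling of `v` to `w`; it has modulus 1 since `U` is
    -- unitary and both vectors are unit vectors.
    set ζ : ℂ := ((‖s.rep‖⁻¹ : ℝ) : ℂ) * t * N ^ n with hζdef
    have hcoord : ∀ x, Matrix.toEuclideanLin (U : Matrix (StabRank.Bits n) (StabRank.Bits n) ℂ)
        (((‖s.rep‖⁻¹ : ℝ) : ℂ) • s.rep) x = ζ * ∏ i, w (x i) := by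
      intro x
      have h2 : Matrix.toEuclideanLin (U : Matrix (StabRank.Bits n) (StabRank.Bits n) ℂ)
          (((‖s.rep‖⁻¹ : ℝ) : ℂ) • s.rep) x = ((‖s.rep‖⁻¹ : ℝ) : ℂ) * (t * ∏ i, v (x i)) := by
        rw [map_smul, PiLp.smul_apply, smul_eq_mul, ← ht, map_smul, PiLp.smul_apply, smul_eq_mul,
          hUM, StabRank.tensorOp_tensorPow, ht]
      rw [h2]
      simp only [w, Finset.prod_div_distrib, Finset.prod_const, Finset.card_univ, Fintype.card_fin]
      rw [hζdef]
      field_simp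
    have hζ : ‖ζ‖ = 1 := by
      have h3 : ‖Matrix.toEuclideanLin (U : Matrix (StabRank.Bits n) (StabRank.Bits n) ℂ)
          (((‖s.rep‖⁻¹ : ℝ) : ℂ) • s.rep)‖ ^ 2 = ‖ζ‖ ^ 2 := by
        rw [EuclideanSpace.norm_sq_eq]
        simp only [hcoord, norm_mul, mul_pow]
        rw [← Finset.mul_sum, StabRank.sum_norm_prod_sq w hw, mul_one]
      rw [StabRank.norm_toEuclideanLin_of_unitary, norm_smul, Complex.norm_real, norm_inv,
        norm_norm, inv_mul_cancel₀ (norm_ne_zero_iff.mpr s.rep_nonzero), one_pow] at h3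
      exact (pow_eq_one_iff_of_nonneg (norm_nonneg _) two_ne_zero).mp h3.symm
    exact StabRank.stabRank_lower_bound_of_close (hcore n h64) hU hζ hcoord hφ hclose
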